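/- **Setting.** All manifolds are real, smooth and without boundary (finite-dimensional or, more generally, modelled on Banach spaces). A *cocycle matched pair* $(M,H)$ consists of a manifold $M$ with a distinguished point $o$, a Lie group $H$ with unit $1$, a smooth left action $\triangleright:H\times M\to M$ with $h\triangleright o=o$, and smooth maps $\sigma:H\times M\to H$, $\cdot:M\times M\to M$, $\gamma:M\times M\to H$ such that $$\sigma(h,o)=h,\quad \sigma(1,m)=1,\quad o\cdot m=m=m\cdot o,\quad \gamma(m,o)=1=\gamma(o,m),$$ $$h\triangleright(m_1\cdot m_2)=(h\triangleright m_1)\cdot(\sigma(h,m_1)\triangleright m_2),$$ $$\sigma(h,m_1\cdot m_2)\,\gamma(m_1,m_2)=\gamma(h\triangleright m_1,\sigma(h,m_1)\triangleright m_2)\,\sigma(\sigma(h,m_1),m_2),$$ $$\sigma(h_1h_2,m)=\sigma(h_1,h_2\triangleright m)\,\sigma(h_2,m),\qquad m_1\cdot(m_2\cdot m_3)=(m_1\cdot m_2)\cdot(\gamma(m_1,m_2)\triangleright m_3),$$ $$\gamma(m_1,m_2\cdot m_3)\,\gamma(m_2,m_3)=\gamma(m_1\cdot m_2,\gamma(m_1,m_2)\triangleright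 m_3)\,\sigma(\gamma(m_1,m_2),m_3),$$ and for every $m$ there is $m^r\in M$ with $m\cdot m^r=o$. The *cocycle double cross product* (unified product) $M\bowtie_\gamma H$ is the manifold $M\times H$ with the Lie group structure $$(m_1,h_1)(m_2,h_2)=\big(m_1\cdot(h_1\triangleright m_2),\ \gamma(m_1,h_1\triangleright m_2)\,\sigma(h_1,m_2)\,h_2\big),$$ whose unit is $(o,1)$. For a Lie group $G$ with Lie algebra $\mathfrak g=T_1G$, the tangent bundle $TG$ is a Lie group whose multiplication is the tangent map of that of $G$; we identify $TG$ with $G\times\mathfrak g$ by the left trivialization $X\in T_gG\mapsto(g,TL_{g^{-1}}X)$. Let $\mathfrak h=T_1H$. **Notation.** Applying $\triangleright$, $\cdot$, $\sigma$, $\gamma$ or the multiplication of $H$ to a tangent vector in one of the slots means applying the corresponding partial tangent map; $L_h,R_h$ are the translations of $H$, and $\mathcal L_m(n)=m\cdot n$, $\mathcal R_m(n)=n\cdot m$ on $M$. For $m\in M$, $v\in T_oM$ put $A=\gamma(m,m^r)^{-1}$ and $$a_m(v)=T\mathcal L_{m^r}\big(A\triangleright T\mathcal R_m v\big)\in T_oM,$$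 $$b_m(v)=TR_{\sigma(A,m)}\Big(\gamma\big(m^r,A\triangleright T\mathcal R_mv\big)+\gamma(m^r,A\triangleright m)\,\gamma(A\triangleright v,A\triangleright m)\Big)+TL_{\gamma(m^r,A\triangleright m)}\,\sigma(\sigma(A,v),m)\in\mathfrak h .$$ **Proposition.** Let $G=M\bowtie_\gamma H$ be a cocycle double cross product Lie group. Then the tangent group $TG$ is again a cocycle double cross product: there is a cocycle matched pair structure on $(M\times T_oM,\,TH)$, with distinguished point $(o,0)$ and twisted cocycle $\Lambda:(M\times T_oM)\times(M\times T_oM)\to TH$ given, in the left trivialization $TH\cong H\times\mathfrak h$, by $$\Lambda\big((m_1,v_1),(m_2,v_2)\big)=\Big(\gamma(m_1,m_2),\ b_{m_2}(v_1)+TL_{\gamma(m_1,m_2)^{-1}}\,\sigma\big(\gamma(m_1,m_2),\,v_2+a_{m_2}(v_1)\big)\Big),$$ and an isomorphism of Lie groups $$\Psi:(M\times T_oM)\bowtie_\Lambda TH\ \longrightarrow\ T(M\bowtie_\gamma H),\qquad \Psi\big((m,v),Y\big)=i(m,v)\,j(Y).$$ Here $i(m,v)=\big((m,1),(v,0)\big)$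 and $j(h,\eta)=\big((o,h),(0,\eta)\big)$ in the left trivializations of $TG$ and $TH$, and $j:TH\to TG$ is an injective smooth group homomorphism. Moreover, in the left trivialization of $TG$, $$i(m_1,v_1)\,i(m_2,v_2)=\Big(\big(m_1\cdot m_2,\gamma(m_1,m_2)\big),\ \big(v_2+a_{m_2}(v_1),\ b_{m_2}(v_1)\big)\Big).$$ -/

import Mathlib

open scoped Manifold ContDiff Topology
open Bundle

section Inv
variable {E : Type*} [NormedAddCommGroup E] [NormedSpace ℝ E]
  {HM : Type*} [TopologicalSpace HM] (I : ModelWithCorners ℝ E HM)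
  {G : Type*} [TopologicalSpace G] [ChartedSpace HM G] [Group G]

theorem contMDiffAt_inv_one_aux [CompleteSpace E] [I.Boundaryless] [ContMDiffMul I ∞ G] :
    ContMDiffAt I I ∞ (fun g : G => g⁻¹) 1 := by
  set e := extChartAt I (1 : G) with he
  set c : E := e 1 with hc
  have hmul : ContMDiffAt (I.prod I) I ∞ (fun p : G × G => p.1 * p.2) ((1 : G), (1 : G)) :=
    (contMDiff_mul I ∞).contMDiffAt
  have hcont : Continuous (fun p : G × G => p.1 * p.2) := (contMDiff_mul I ∞).continuous
  set f : E × E → E := fun q => e (e.symm q.1 * e.symm q.2) with hf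
  have hfs : ContDiffAt ℝ ∞ f (c, c) := by
    have h := (contMDiffAt_iff.1 hmul).2
    have hr : Set.range (I.prod I) = Set.univ := ModelWithCorners.range_eq_univ _
    rw [hr, contDiffWithinAt_univ] at h
    simp only [extChartAt_prod, mul_one] at h
    exact h
  have he1 : e.symm c = 1 := extChartAt_to_inv (I := I) (1 : G)
  have hsrc : e.source ∈ 𝓝 (1 : G) := extChartAt_source_mem_nhds (I := I) (1 : G)
  have htgt : e.target ∈ 𝓝 c := extChartAt_target_mem_nhds (I := I) (1 : G)
  have hsymm : ContinuousAt e.symm c := continuousAt_extChartAt_symm (I := I) (1 : G)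
  have hfd : HasFDerivAt f (fderiv ℝ f (c, c)) (c, c) :=
    (hfs.differentiableAt (by simp)).hasFDerivAt
  have hD1 : ∀ a : E, fderiv ℝ f (c, c) (a, 0) = a := by
    have h1 : HasFDerivAt (fun u : E => (u, c)) (ContinuousLinearMap.inl ℝ E E) c :=
      hasFDerivAt_prodMk_left c c
    have h2 := HasFDerivAt.comp (f := fun u : E => (u, c)) c hfd h1
    have h3 : (f ∘ fun u : E => (u, c)) =ᶠ[𝓝 c] id := by
      filter_upwards [htgt] with u hu
      simp [hf, he1, e.right_inv hu]
    have h4 := (h2.congr_of_eventuallyEq h3.symm).unique (hasFDerivAt_id c)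
    intro a
    simpa using DFunLike.congr_fun h4 a
  have hD2 : ∀ a : E, fderiv ℝ f (c, c) (0, a) = a := by
    have h1 : HasFDerivAt (fun u : E => (c, u)) (ContinuousLinearMap.inr ℝ E E) c :=
      hasFDerivAt_prodMk_right c c
    have h2 := HasFDerivAt.comp (f := fun u : E => (c, u)) c hfd h1
    have h3 : (f ∘ fun u : E => (c, u)) =ᶠ[𝓝 c] id := by
      filter_upwards [htgt] with u hu
      simp [hf, he1, e.right_inv hu]
    have h4 := (h2.congr_of_eventuallyEq h3.symm).unique (hasFDerivAt_id c)
    intro a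
    simpa using DFunLike.congr_fun h4 a
  set S : E × E → E × E := fun q => (q.1, f q) with hS
  let L : (E × E) ≃L[ℝ] (E × E) :=
    (ContinuousLinearEquiv.refl ℝ E).skewProd (ContinuousLinearEquiv.refl ℝ E)
      (ContinuousLinearMap.id ℝ E)
  have hSs : ContDiffAt ℝ ∞ S (c, c) := contDiffAt_fst.prodMk hfs
  have hSd : HasFDerivAt S (L : E × E →L[ℝ] E × E) (c, c) := by
    have h := (hasFDerivAt_fst (𝕜 := ℝ) (p := (c, c))).prodMk hfd
    have hL : (L : E × E →L[ℝ] E × E) =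
        (ContinuousLinearMap.fst ℝ E E).prod (fderiv ℝ f (c, c)) := by
      refine ContinuousLinearMap.ext fun q => ?_
      have hq : q = (q.1, 0) + (0, q.2) := by simp
      have h5 : fderiv ℝ f (c, c) q = q.1 + q.2 := by
        conv_lhs => rw [hq]
        rw [map_add, hD1, hD2]
      refine Prod.ext ?_ ?_
      · simp [L]
      · simp [L, h5, add_comm]
    rw [hL]
    exact h
  have hn : (∞ : WithTop ℕ∞) ≠ 0 := by simp
  have hSc : S (c, c) = (c, c) := by
    have : f (c, c) = c := by simp only [hf, he1, mul_one]; rfl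
    simp only [hS, this]
  set T := hSs.localInverse hSd hn with hT
  have hTs : ContDiffAt ℝ ∞ T (c, c) := by
    have := hSs.to_localInverse hSd hn
    rwa [hSc] at this
  have hTc : T (c, c) = (c, c) := by
    have := hSs.localInverse_apply_image hSd hn
    rwa [hSc] at this
  have hTr : ∀ᶠ q in 𝓝 (c, c), S (T q) = q := by
    have h := (hSs.hasStrictFDerivAt' hSd hn).eventually_right_inverse
    rw [hSc] at h
    exact h
  let y : E → E := fun u => (T (u, c)).2
  have hpair : ContDiffAt ℝ ∞ (fun u : E => (u, c)) c := contDiffAt_id.prodMk contDiffAt_const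
  have hys : ContDiffAt ℝ ∞ y c :=
    contDiffAt_snd.comp c (ContDiffAt.comp c (f := fun u : E => (u, c)) hTs hpair)
  have hyc : y c = c := by simp [y, hTc]
  have hev : ∀ᶠ u in 𝓝 c, S (T (u, c)) = (u, c) :=
    hpair.continuousAt.eventually hTr
  have hyt : Filter.Tendsto (fun g : G => (e.symm (y (e g)))) (𝓝 1) (𝓝 1) := by
    have h1 : ContinuousAt e (1 : G) := continuousAt_extChartAt (I := I) (1 : G)
    have h2 : ContinuousAt y c := hys.continuousAt
    have h3 : ContinuousAt e.symm (y c) := by rw [hyc]; exact hsymm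
    have := ContinuousAt.comp (f := e) (g := fun u => e.symm (y u)) (x := (1 : G))
      (ContinuousAt.comp (f := y) (g := e.symm) (x := c) h3 h2) h1
    have h4 : e.symm (y (e 1)) = 1 := by rw [← hc, hyc, he1]
    have h5 := this.tendsto
    simp only [Function.comp_def, h4] at h5
    exact h5
  have hprod : ∀ᶠ g in 𝓝 (1 : G), g * e.symm (y (e g)) ∈ e.source := by
    have h1 : Filter.Tendsto (fun g : G => (g, e.symm (y (e g)))) (𝓝 1) (𝓝 (1, 1)) :=
      Filter.Tendsto.prodMk_nhds Filter.tendsto_id hyt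
    have h2 : Filter.Tendsto (fun p : G × G => p.1 * p.2) (𝓝 (1, 1)) (𝓝 1) := by
      simpa using hcont.tendsto ((1 : G), (1 : G))
    exact (h2.comp h1).eventually hsrc
  have hinv : (fun g : G => g⁻¹) =ᶠ[𝓝 1] fun g => e.symm (y (e g)) := by
    have h1 : ContinuousAt e (1 : G) := continuousAt_extChartAt (I := I) (1 : G)
    filter_upwards [hsrc, hprod, h1.eventually hev] with g hg hp hq
    have hq1 : (T (e g, c)).1 = e g := congrArg Prod.fst hq
    have hq2 : e (e.symm (T (e g, c)).1 * e.symm (T (e g, c)).2) = c := congrArg Prod.snd hq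
    rw [hq1, e.left_inv hg] at hq2
    have h3 := e.injOn hp (mem_extChartAt_source (I := I) (1 : G)) hq2
    exact inv_eq_of_mul_eq_one_right h3
  refine ContMDiffAt.congr_of_eventuallyEq ?_ hinv
  have g1 : ContMDiffAt I 𝓘(ℝ, E) ∞ e (1 : G) := contMDiffAt_extChartAt
  have g2 : ContMDiffAt 𝓘(ℝ, E) 𝓘(ℝ, E) ∞ y (e 1) := hys.contMDiffAt
  have g3 : ContMDiffAt 𝓘(ℝ, E) I ∞ e.symm (y (e 1)) := by
    rw [← hc, hyc]
    exact (contMDiffOn_extChartAt_symm (I := I) (n := ∞) (1 : G)).contMDiffAt htgt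
  exact g3.comp (1 : G) (g2.comp (1 : G) g1)

/-- A group with smooth multiplication on a Banach manifold without boundary is a Lie group. -/
theorem lieGroup_of_contMDiffMul [CompleteSpace E] [I.Boundaryless] [ContMDiffMul I ∞ G] :
    LieGroup I ∞ G where
  contMDiff_inv := by
    intro g
    have h1 : ContMDiff I I ∞ (fun x : G => g⁻¹ * x) := contMDiff_mul_left
    have h2 : ContMDiff I I ∞ (fun x : G => x * g⁻¹) := contMDiff_mul_right
    have h3 : ContMDiffAt I I ∞ (fun x : G => x⁻¹) (g⁻¹ * g) := by
      rw [inv_mul_cancel]; exact contMDiffAt_inv_one_aux I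
    have h4 := h2.contMDiffAt.comp g (h3.comp g (h1.contMDiffAt (x := g)))
    refine h4.congr_of_eventuallyEq (Filter.Eventually.of_forall fun x => ?_)
    simp [Function.comp]
end Inv

section TG
variable {E : Type*} [NormedAddCommGroup E] [NormedSpace ℝ E]
  {HM : Type*} [TopologicalSpace HM] {I : ModelWithCorners ℝ E HM}
  {G : Type*} [TopologicalSpace G] [ChartedSpace HM G] [Group G]


variable {EN : Type*} [NormedAddCommGroup EN] [NormedSpace ℝ EN]
  {HN : Type*} [TopologicalSpace HN] {IN : ModelWithCorners ℝ EN HN}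
  {N : Type*} [TopologicalSpace N] [ChartedSpace HN N]

/-- The multiplication of the tangent group `T G`: the tangent map of the multiplication of `G`. -/
noncomputable def tangentMul (X Y : TangentBundle I G) : TangentBundle I G :=
  tangentMap (I.prod I) I (fun p : G × G => p.1 * p.2) ((equivTangentBundleProd I G I G).symm (X, Y))

theorem tangentMul_tangentMap [ContMDiffMul I ∞ G] {f g : N → G} (hf : MDifferentiable IN I f)
    (hg : MDifferentiable IN I g) (W : TangentBundle IN N) :
    tangentMul (tangentMap IN I f W) (tangentMap IN I g W) =
      tangentMap IN I (fun w => f w * g w) W := by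
  have hm : MDifferentiable (I.prod I) I (fun p : G × G => p.1 * p.2) :=
    (contMDiff_mul I ∞).mdifferentiable (by simp)
  have h := congrFun (tangentMap_comp (I := IN) hm (hf.prodMk hg)) W
  refine Eq.trans ?_ h.symm
  unfold tangentMul
  refine congrArg (tangentMap (I.prod I) I (fun p : G × G => p.1 * p.2)) ?_
  simp only [tangentMap, mfderiv_prodMk (hf W.proj) (hg W.proj)]
  rfl

/-- The tangent group `T G` of a Lie group `G`. -/
noncomputable instance tangentGroup [LieGroup I ∞ G] : Group (TangentBundle I G) where
  mul := tangentMul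
  one := ⟨1, 0⟩
  inv X := tangentMap I I (fun g : G => g⁻¹) X
  mul_assoc X Y Z := by
    let W := (equivTangentBundleProd (I.prod I) (G × G) I G).symm
      ((equivTangentBundleProd I G I G).symm (X, Y), Z)
    have f1 : MDifferentiable ((I.prod I).prod I) I (fun w : (G × G) × G => w.1.1) :=
      mdifferentiable_fst.comp mdifferentiable_fst
    have f2 : MDifferentiable ((I.prod I).prod I) I (fun w : (G × G) × G => w.1.2) :=
      mdifferentiable_snd.comp mdifferentiable_fst
    have f3 : MDifferentiable ((I.prod I).prod I) I (fun w : (G × G) × G => w.2) :=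
      mdifferentiable_snd
    have hm : MDifferentiable (I.prod I) I (fun p : G × G => p.1 * p.2) :=
      (contMDiff_mul I ∞).mdifferentiable (by simp)
    have hX : tangentMap ((I.prod I).prod I) I (fun w : (G × G) × G => w.1.1) W = X := by
      have := congrFun (tangentMap_comp (I := (I.prod I).prod I) (mdifferentiable_fst (I := I)
        (I' := I) (M := G) (M' := G)) (mdifferentiable_fst (I := I.prod I) (I' := I))) W
      refine Eq.trans this ?_
      simp only [Function.comp, tangentMap_prodFst]
      rfl
    have hY : tangentMap ((I.prod I).prod I) I (fun w : (G × G) × G => w.1.2) W = Y := by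
      have := congrFun (tangentMap_comp (I := (I.prod I).prod I) (mdifferentiable_snd (I := I)
        (I' := I) (M := G) (M' := G)) (mdifferentiable_fst (I := I.prod I) (I' := I))) W
      refine Eq.trans this ?_
      simp only [Function.comp, tangentMap_prodFst, tangentMap_prodSnd]
      rfl
    have hZ : tangentMap ((I.prod I).prod I) I (fun w : (G × G) × G => w.2) W = Z := by
      simp only [tangentMap_prodSnd]
      rfl
    change tangentMul (tangentMul X Y) Z = tangentMul X (tangentMul Y Z)
    have f12 : MDifferentiable ((I.prod I).prod I) I (fun w : (G × G) × G => w.1.1 * w.1.2) :=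
      hm.comp (f1.prodMk f2)
    have f23 : MDifferentiable ((I.prod I).prod I) I (fun w : (G × G) × G => w.1.2 * w.2) :=
      hm.comp (f2.prodMk f3)
    rw [← hX, ← hY, ← hZ, tangentMul_tangentMap f1 f2, tangentMul_tangentMap f2 f3,
      tangentMul_tangentMap f12 f3, tangentMul_tangentMap f1 f23]
    simp only [mul_assoc]
  one_mul X := by
    have h1 : tangentMap I I (fun _ : G => (1 : G)) X = ⟨1, 0⟩ := by
      simp [tangentMap]
    change tangentMul ⟨1, 0⟩ X = X
    have h2 := tangentMul_tangentMap (I := I) (mdifferentiable_const (c := (1 : G)))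
      (mdifferentiable_id (I := I) (M := G)) X
    rw [h1, tangentMap_id] at h2
    refine h2.trans ?_
    simp only [one_mul, id]
    exact congrFun (tangentMap_id (I := I) (M := G)) X
  mul_one X := by
    have h1 : tangentMap I I (fun _ : G => (1 : G)) X = ⟨1, 0⟩ := by
      simp [tangentMap]
    change tangentMul X ⟨1, 0⟩ = X
    have h2 := tangentMul_tangentMap (I := I) (mdifferentiable_id (I := I) (M := G))
      (mdifferentiable_const (c := (1 : G))) X
    rw [h1, tangentMap_id] at h2
    refine h2.trans ?_
    simp only [mul_one, id]
    exact congrFun (tangentMap_id (I := I) (M := G)) X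
  inv_mul_cancel X := by
    have h1 : tangentMap I I (fun _ : G => (1 : G)) X = ⟨1, 0⟩ := by
      simp [tangentMap]
    change tangentMul (tangentMap I I (fun g : G => g⁻¹) X) X = ⟨1, 0⟩
    have h2 := tangentMul_tangentMap (I := I)
      ((contMDiff_inv I ∞ : ContMDiff I I ∞ (fun g : G => g⁻¹)).mdifferentiable (by simp))
      (mdifferentiable_id (I := I) (M := G)) X
    simpa [tangentMap_id, h1] using h2

instance tangentLieGroup [LieGroup I ∞ G] : LieGroup I.tangent ∞ (TangentBundle I G) where
  contMDiff_mul := by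
    have h := (contMDiff_mul I ∞ (G := G)).contMDiff_tangentMap (m := ∞) (by simp)
    exact h.comp contMDiff_equivTangentBundleProd_symm
  contMDiff_inv :=
    (contMDiff_inv I ∞ (G := G)).contMDiff_tangentMap (m := ∞) (by simp)

theorem mfderiv_translate_cancel [LieGroup I ∞ G] (a b g : G) (hab : a * b = 1)
    (v : TangentSpace I g) :
    (mfderiv I I (fun x : G => a * x) (b * g) (mfderiv I I (fun x : G => b * x) g v) : E) = v := by
  have h1 : MDifferentiable I I (fun x : G => a * x) :=
    (contMDiff_mul_left (I := I) (n := ∞)).mdifferentiable (by simp)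
  have h2 : MDifferentiable I I (fun x : G => b * x) :=
    (contMDiff_mul_left (I := I) (n := ∞)).mdifferentiable (by simp)
  have h3 := mfderiv_comp_apply g (h1 (b * g)) (h2 g) v
  have h4 : (fun x : G => a * x) ∘ (fun x : G => b * x) = id := by
    funext x; simp [← mul_assoc, hab]
  rw [h4, mfderiv_id] at h3
  exact h3.symm

/-- The left trivialization `T G ≅ G × 𝔤`, `X ∈ T_g G ↦ (g, T L_{g⁻¹} X)`, whose inverse is
`(g, ξ) ↦ T L_g ξ`. -/
noncomputable def leftTriv [LieGroup I ∞ G] : TangentBundle I G ≃ G × GroupLieAlgebra I G where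
  toFun X := (X.proj, (mfderiv I I (fun x : G => X.proj⁻¹ * x) X.proj X.2 : E))
  invFun p := ⟨p.1, (mfderiv I I (fun x : G => p.1 * x) 1 p.2 : E)⟩
  left_inv X := by
    obtain ⟨g, v⟩ := X
    have h := mfderiv_translate_cancel (I := I) g g⁻¹ g (mul_inv_cancel g) v
    rw [inv_mul_cancel] at h
    exact congrArg (TotalSpace.mk g) h
  right_inv p := by
    obtain ⟨g, v⟩ := p
    have h := mfderiv_translate_cancel (I := I) g⁻¹ g 1 (inv_mul_cancel g) v
    rw [mul_one] at h
    exact congrArg (Prod.mk g) h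

end TG


section Tvec
variable {E : Type*} [NormedAddCommGroup E] [NormedSpace ℝ E]
  {HM : Type*} [TopologicalSpace HM] {I : ModelWithCorners ℝ E HM}
  {M : Type*} [TopologicalSpace M] [ChartedSpace HM M]

/-- A tangent space, as a manifold: it is a vector space, modelled on itself. -/
instance tangentSpaceChartedSpace (x : M) : ChartedSpace E (TangentSpace I x) :=
  inferInstanceAs (ChartedSpace E E)

instance tangentSpaceIsManifold (x : M) : IsManifold 𝓘(ℝ, E) ∞ (TangentSpace I x) :=
  inferInstanceAs (IsManifold 𝓘(ℝ, E) ∞ E)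
end Tvec

/-- A cocycle matched pair `(M, H)`: a manifold `M` with a distinguished point `o`, a Lie group `H`
acting on `M`, and smooth maps `dot : M × M → M`, `gam : M × M → H`, `sig : H × M → H`. -/
structure CocycleMatchedPair
    {EM : Type*} [NormedAddCommGroup EM] [NormedSpace ℝ EM]
    {BM : Type*} [TopologicalSpace BM] (I : ModelWithCorners ℝ EM BM)
    {EH : Type*} [NormedAddCommGroup EH] [NormedSpace ℝ EH]
    {BH : Type*} [TopologicalSpace BH] (J : ModelWithCorners ℝ EH BH)
    (M : Type*) [TopologicalSpace M] [ChartedSpace BM M] [IsManifold I ∞ M]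
    (H : Type*) [TopologicalSpace H] [ChartedSpace BH H] [Group H] [LieGroup J ∞ H] where
  o : M
  act : H → M → M
  sig : H → M → H
  dot : M → M → M
  gam : M → M → H
  contMDiff_act : ContMDiff (J.prod I) I ∞ (fun p : H × M => act p.1 p.2)
  contMDiff_sig : ContMDiff (J.prod I) J ∞ (fun p : H × M => sig p.1 p.2)
  contMDiff_dot : ContMDiff (I.prod I) I ∞ (fun p : M × M => dot p.1 p.2)
  contMDiff_gam : ContMDiff (I.prod I) J ∞ (fun p : M × M => gam p.1 p.2)
  one_act : ∀ m, act 1 m = m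
  mul_act : ∀ h₁ h₂ m, act (h₁ * h₂) m = act h₁ (act h₂ m)
  act_o : ∀ h, act h o = o
  sig_o : ∀ h, sig h o = h
  one_sig : ∀ m, sig 1 m = 1
  o_dot : ∀ m, dot o m = m
  dot_o : ∀ m, dot m o = m
  gam_o : ∀ m, gam m o = 1
  o_gam : ∀ m, gam o m = 1
  act_dot : ∀ h m₁ m₂, act h (dot m₁ m₂) = dot (act h m₁) (act (sig h m₁) m₂)
  sig_dot : ∀ h m₁ m₂,
    sig h (dot m₁ m₂) * gam m₁ m₂ = gam (act h m₁) (act (sig h m₁) m₂) * sig (sig h m₁) m₂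
  mul_sig : ∀ h₁ h₂ m, sig (h₁ * h₂) m = sig h₁ (act h₂ m) * sig h₂ m
  dot_assoc : ∀ m₁ m₂ m₃, dot m₁ (dot m₂ m₃) = dot (dot m₁ m₂) (act (gam m₁ m₂) m₃)
  gam_cocycle : ∀ m₁ m₂ m₃,
    gam m₁ (dot m₂ m₃) * gam m₂ m₃ =
      gam (dot m₁ m₂) (act (gam m₁ m₂) m₃) * sig (gam m₁ m₂) m₃
  exists_rightInv : ∀ m, ∃ n, dot m n = o

namespace CocycleMatchedPair

variable {EM : Type*} [NormedAddCommGroup EM] [NormedSpace ℝ EM]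
  {BM : Type*} [TopologicalSpace BM] {I : ModelWithCorners ℝ EM BM}
  {EH : Type*} [NormedAddCommGroup EH] [NormedSpace ℝ EH]
  {BH : Type*} [TopologicalSpace BH] {J : ModelWithCorners ℝ EH BH}
  {M : Type*} [TopologicalSpace M] [ChartedSpace BM M] [IsManifold I ∞ M]
  {H : Type*} [TopologicalSpace H] [ChartedSpace BH H] [Group H] [LieGroup J ∞ H]

/-- The cocycle double cross product `M ⋈_γ H`: the product manifold `M × H`, with the group
structure below. -/
def Product (_P : CocycleMatchedPair I J M H) : Type _ := M × H

instance (P : CocycleMatchedPair I J M H) : TopologicalSpace P.Product :=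
  inferInstanceAs (TopologicalSpace (M × H))

instance (P : CocycleMatchedPair I J M H) : ChartedSpace (ModelProd BM BH) P.Product :=
  inferInstanceAs (ChartedSpace (ModelProd BM BH) (M × H))

instance (P : CocycleMatchedPair I J M H) : IsManifold (I.prod J) ∞ P.Product :=
  inferInstanceAs (IsManifold (I.prod J) ∞ (M × H))

/-- The element `mʳ` with `m · mʳ = o`. -/
noncomputable def rInv (P : CocycleMatchedPair I J M H) (m : M) : M :=
  Classical.choose (P.exists_rightInv m)

theorem dot_rInv (P : CocycleMatchedPair I J M H) (m : M) : P.dot m (P.rInv m) = P.o :=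
  Classical.choose_spec (P.exists_rightInv m)

instance (P : CocycleMatchedPair I J M H) : Mul P.Product where
  mul x y := (P.dot x.1 (P.act x.2 y.1), P.gam x.1 (P.act x.2 y.1) * P.sig x.2 y.1 * y.2)

instance (P : CocycleMatchedPair I J M H) : One P.Product where
  one := (P.o, 1)

noncomputable instance (P : CocycleMatchedPair I J M H) : Inv P.Product where
  inv x := (P.act x.2⁻¹ (P.rInv x.1), P.sig x.2⁻¹ (P.rInv x.1) * (P.gam x.1 (P.rInv x.1))⁻¹)

noncomputable instance (P : CocycleMatchedPair I J M H) : Group P.Product :=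
  Group.ofRightAxioms
    (by
      rintro ⟨a, x⟩ ⟨b, y⟩ ⟨c, z⟩
      refine Prod.ext ?_ ?_
      · change P.dot (P.dot a (P.act x b)) (P.act (P.gam a (P.act x b) * P.sig x b * y) c) =
          P.dot a (P.act x (P.dot b (P.act y c)))
        rw [P.act_dot, P.dot_assoc, P.mul_act, P.mul_act]
      · change P.gam (P.dot a (P.act x b)) (P.act (P.gam a (P.act x b) * P.sig x b * y) c) *
            P.sig (P.gam a (P.act x b) * P.sig x b * y) c * z =
          P.gam a (P.act x (P.dot b (P.act y c))) * P.sig x (P.dot b (P.act y c)) *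
            (P.gam b (P.act y c) * P.sig y c * z)
        rw [P.mul_act, P.mul_act, P.mul_sig, P.mul_sig]
        have h1 := P.gam_cocycle a (P.act x b) (P.act (P.sig x b) (P.act y c))
        have h2 := P.sig_dot x b (P.act y c)
        rw [← P.act_dot] at h1
        calc _ = (P.gam (P.dot a (P.act x b)) (P.act (P.gam a (P.act x b))
                (P.act (P.sig x b) (P.act y c))) *
                P.sig (P.gam a (P.act x b)) (P.act (P.sig x b) (P.act y c))) *
                P.sig (P.sig x b) (P.act y c) * P.sig y c * z := by
              simp only [mul_assoc]
          _ = P.gam a (P.act x (P.dot b (P.act y c))) *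
                (P.gam (P.act x b) (P.act (P.sig x b) (P.act y c)) *
                P.sig (P.sig x b) (P.act y c)) * P.sig y c * z := by
              rw [← h1]; simp only [mul_assoc]
          _ = _ := by rw [← h2]; simp only [mul_assoc])
    (by
      rintro ⟨a, x⟩
      refine Prod.ext ?_ ?_
      · change P.dot a (P.act x P.o) = a
        rw [P.act_o, P.dot_o]
      · change P.gam a (P.act x P.o) * P.sig x P.o * 1 = x
        rw [P.act_o, P.gam_o, P.sig_o, one_mul, mul_one])
    (by
      rintro ⟨a, x⟩
      have h : P.act x (P.act x⁻¹ (P.rInv a)) = P.rInv a := by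
        rw [← P.mul_act, mul_inv_cancel, P.one_act]
      refine Prod.ext ?_ ?_
      · change P.dot a (P.act x (P.act x⁻¹ (P.rInv a))) = P.o
        rw [h, P.dot_rInv]
      · change P.gam a (P.act x (P.act x⁻¹ (P.rInv a))) * P.sig x (P.act x⁻¹ (P.rInv a)) *
          (P.sig x⁻¹ (P.rInv a) * (P.gam a (P.rInv a))⁻¹) = 1
        have h3 := P.mul_sig x x⁻¹ (P.rInv a)
        rw [mul_inv_cancel, P.one_sig] at h3
        rw [h, mul_assoc, ← mul_assoc (P.sig x _), ← h3, one_mul, mul_inv_cancel])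

instance (P : CocycleMatchedPair I J M H) : ContMDiffMul (I.prod J) ∞ P.Product where
  contMDiff_mul := by
    have a1 : ContMDiff ((I.prod J).prod (I.prod J)) I ∞
        (fun p : (M × H) × (M × H) => p.1.1) := contMDiff_fst.comp contMDiff_fst
    have a2 : ContMDiff ((I.prod J).prod (I.prod J)) J ∞
        (fun p : (M × H) × (M × H) => p.1.2) := contMDiff_snd.comp contMDiff_fst
    have a3 : ContMDiff ((I.prod J).prod (I.prod J)) I ∞
        (fun p : (M × H) × (M × H) => p.2.1) := contMDiff_fst.comp contMDiff_snd
    have a4 : ContMDiff ((I.prod J).prod (I.prod J)) J ∞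
        (fun p : (M × H) × (M × H) => p.2.2) := contMDiff_snd.comp contMDiff_snd
    have b1 : ContMDiff ((I.prod J).prod (I.prod J)) I ∞
        (fun p : (M × H) × (M × H) => P.act p.1.2 p.2.1) :=
      P.contMDiff_act.comp (a2.prodMk a3)
    have b2 : ContMDiff ((I.prod J).prod (I.prod J)) J ∞
        (fun p : (M × H) × (M × H) => P.sig p.1.2 p.2.1) :=
      P.contMDiff_sig.comp (a2.prodMk a3)
    have b3 : ContMDiff ((I.prod J).prod (I.prod J)) I ∞
        (fun p : (M × H) × (M × H) => P.dot p.1.1 (P.act p.1.2 p.2.1)) :=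
      P.contMDiff_dot.comp (a1.prodMk b1)
    have b4 : ContMDiff ((I.prod J).prod (I.prod J)) J ∞
        (fun p : (M × H) × (M × H) => P.gam p.1.1 (P.act p.1.2 p.2.1)) :=
      P.contMDiff_gam.comp (a1.prodMk b1)
    exact b3.prodMk ((b4.mul b2).mul a4)

instance [CompleteSpace EM] [CompleteSpace EH] [I.Boundaryless] [J.Boundaryless]
    (P : CocycleMatchedPair I J M H) : LieGroup (I.prod J) ∞ P.Product :=
  lieGroup_of_contMDiffMul (I.prod J)

/-- The `T_o M`-component `T𝓛_{mʳ}(γ(m, mʳ)⁻¹ ▷ T𝓡_m v)` of `Ad_{(m,1)⁻¹}(v, 0)`. -/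
noncomputable def adM (P : CocycleMatchedPair I J M H) (m : M) (v : TangentSpace I P.o) :
    TangentSpace I P.o :=
  let r := P.rInv m
  let A := (P.gam m r)⁻¹
  let v₁ : TangentSpace I m := (mfderiv I I (fun n => P.dot n m) P.o v : EM)
  let v₂ : TangentSpace I (P.act A m) := mfderiv I I (fun n => P.act A n) m v₁
  (mfderiv I I (fun n => P.dot r n) (P.act A m) v₂ : EM)

/-- The `𝔥`-component of `Ad_{(m,1)⁻¹}(v, 0)`: with `A = γ(m, mʳ)⁻¹`,
`TR_{σ(A,m)} ( γ(mʳ, A ▷ T𝓡_m v) + γ(mʳ, A ▷ m) ∗ γ(A ▷ v, A ▷ m) )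
  + TL_{γ(mʳ, A ▷ m)} σ(σ(A, v), m)`. -/
noncomputable def adH (P : CocycleMatchedPair I J M H) (m : M) (v : TangentSpace I P.o) :
    GroupLieAlgebra J H :=
  let r := P.rInv m
  let A := (P.gam m r)⁻¹
  let g := P.gam r (P.act A m)
  let v₁ : TangentSpace I m := (mfderiv I I (fun n => P.dot n m) P.o v : EM)
  let v₂ : TangentSpace I (P.act A m) := mfderiv I I (fun n => P.act A n) m v₁
  -- `γ(mʳ, A ▷ T𝓡_m v)`
  let t₁ : TangentSpace J g := mfderiv I J (fun n => P.gam r n) (P.act A m) v₂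
  -- `A ▷ v` and `γ(A ▷ v, A ▷ m)`
  let v₃ : TangentSpace I P.o := (mfderiv I I (fun n => P.act A n) P.o v : EM)
  let t₂ : TangentSpace J (1 : H) := (mfderiv I J (fun n => P.gam n (P.act A m)) P.o v₃ : EH)
  let t₃ : TangentSpace J g := (mfderiv J J (fun h => g * h) 1 t₂ : EH)
  -- `σ(A, v)` and `σ(σ(A, v), m)`
  let t₄ : TangentSpace J A := (mfderiv I J (fun n => P.sig A n) P.o v : EH)
  let t₅ : TangentSpace J (P.sig A m) := mfderiv J J (fun h => P.sig h m) A t₄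
  (mfderiv J J (fun h => h * P.sig A m) g (t₁ + t₃) : EH) +
    (mfderiv J J (fun h => g * h) (P.sig A m) t₅ : EH)

/-- `TL_{h⁻¹} σ(h, v) ∈ 𝔥`, for `v ∈ T_o M`. -/
noncomputable def sigLog (P : CocycleMatchedPair I J M H) (h : H) (v : TangentSpace I P.o) :
    GroupLieAlgebra J H :=
  let t : TangentSpace J h := (mfderiv I J (fun n => P.sig h n) P.o v : EH)
  (mfderiv J J (fun x => h⁻¹ * x) h t : EH)

/-- The twisted cocycle `Λ : (M × T_o M) × (M × T_o M) → T H`, in terms of the left trivialization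
`T H ≅ H × 𝔥`. -/
noncomputable def Lam (P : CocycleMatchedPair I J M H) (x y : M × TangentSpace I P.o) :
    TangentBundle J H :=
  leftTriv.symm (P.gam x.1 y.1,
    P.adH y.1 x.2 + P.sigLog (P.gam x.1 y.1) (y.2 + P.adM y.1 x.2))

variable [CompleteSpace EM] [CompleteSpace EH] [I.Boundaryless] [J.Boundaryless]

/-- `M × T_o M → T(M ⋈_γ H)`, which is `(m, v) ↦ ((m, 1), (v, 0))` in the left trivialization. -/
noncomputable def inclM (P : CocycleMatchedPair I J M H) (x : M × TangentSpace I P.o) :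
    TangentBundle (I.prod J) P.Product :=
  leftTriv.symm (((x.1, 1) : M × H), ((x.2, 0) : EM × EH))

/-- `T H → T(M ⋈_γ H)`, which is `(h, η) ↦ ((o, h), (0, η))` in the left trivializations. -/
noncomputable def inclTH (P : CocycleMatchedPair I J M H) (Y : TangentBundle J H) :
    TangentBundle (I.prod J) P.Product :=
  leftTriv.symm (((P.o, (leftTriv Y).1) : M × H), ((0, (leftTriv Y).2) : EM × EH))

end CocycleMatchedPair

/-!
Let `G = M ⋈_γ H`, let `j₀ h = (o, h)`, a homomorphism `H → G`, and let `i₀ m = (m, 1)`. Every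
element of `G` is uniquely `i₀ m * j₀ h`, and conversely the axioms of a cocycle matched pair are
just what uniqueness and associativity say about such factorizations: the structure maps are the
components of the factorizations of `j₀ h * i₀ m` and of `i₀ m₁ * i₀ m₂`. So it suffices to show
that the Lie group `TG` factors, uniquely and smoothly, as `i(M × T_o M) * j(TH)`, where `j = T j₀`
and `i(m, v)` is the left translate by `i₀ m` of the vector `(v, 0)` at the unit; the matched pair
on `(M × T_o M, TH)` and the isomorphism `Ψ` then come from
`CocycleMatchedPair.ofFactorization` and `CocycleMatchedPair.ofFactorizationMulEquiv`.

The factorization of `X ∈ TG` over `(m, h)` is explicit (`CocycleMatchedPair.tangentFactorization`).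
Right multiplication by `TH` does not change the projection to `TM`, so `v` is the projection of
`i₀(m)⁻¹ X` to `T_o M`, and `i(m, v)⁻¹ X` is a vector over `(o, h)` with vanishing `M`-component,
that is, an element of `j(TH)`. Both components depend smoothly on `X`.

It remains to compute `i(m₁, v₁) * i(m₂, v₂)`. In the left trivialization,
`(g, ξ)(h, ζ) = (g h, Ad_{h⁻¹} ξ + ζ)` (`leftTriv_symm_mul_leftTriv_symm`), and `Ad_{(m, 1)⁻¹}(v, 0)`
is `(a_m(v), b_m(v))`, by differentiating `n ↦ (m, 1)⁻¹ (n, 1) (m, 1)` at `o`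
(`dirDeriv_conj_inl`). The formula for `Λ` follows from the computation of `Ad_{(o, h)⁻¹}(v, 0)`
(`dirDeriv_conj_inr`) and from the derivative of `σ(h⁻¹, h ▷ n) σ(h, n) = 1` at `n = o`.
-/

/-! ### Directional derivatives and tangent vectors -/

section DirDeriv
variable {E : Type*} [NormedAddCommGroup E] [NormedSpace ℝ E]
  {B : Type*} [TopologicalSpace B] (I : ModelWithCorners ℝ E B)
  {M : Type*} [TopologicalSpace M] [ChartedSpace B M]
  {E' : Type*} [NormedAddCommGroup E'] [NormedSpace ℝ E']
  {B' : Type*} [TopologicalSpace B'] (I' : ModelWithCorners ℝ E' B')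
  {M' : Type*} [TopologicalSpace M'] [ChartedSpace B' M']

/-- The derivative of `f` at `x` in the direction `v`. Both `v` and the result are regarded as
elements of the model spaces, so that the base points can be rewritten. -/
noncomputable def dirDeriv (f : M → M') (x : M) (v : E) : E' :=
  mfderiv I I' f x v

/-- The tangent vector at `x` given by `v : E`, as a point of the tangent bundle. Like `dirDeriv`,
it takes `v` in the model space. -/
def tangentVec (x : M) (v : E) : TangentBundle I M := TotalSpace.mk x v

/-- The vector part of a point of the tangent bundle, in the model space. -/
def tangentVecPart {I : ModelWithCorners ℝ E B} (X : TangentBundle I M) : E := X.2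

variable {I I'}

@[simp] theorem tangentVecPart_tangentVec (x : M) (v : E) :
    tangentVecPart (tangentVec I x v) = v := rfl

theorem tangentVec_eta (X : TangentBundle I M) : tangentVec I X.proj (tangentVecPart X) = X := rfl

theorem tangentMap_tangentVec (f : M → M') (x : M) (v : E) :
    tangentMap I I' f (tangentVec I x v) = tangentVec I' (f x) (dirDeriv I I' f x v) := rfl

theorem dirDeriv_add (f : M → M') (x : M) (v w : E) :
    dirDeriv I I' f x (v + w) = dirDeriv I I' f x v + dirDeriv I I' f x w :=
  map_add (mfderiv I I' f x) v w

theorem dirDeriv_zero (f : M → M') (x : M) : dirDeriv I I' f x (0 : E) = 0 :=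
  map_zero (mfderiv I I' f x)

theorem dirDeriv_const (c : M') (x : M) (v : E) :
    dirDeriv I I' (fun _ : M => c) x v = 0 := by
  unfold dirDeriv
  rw [mfderiv_const]
  rfl

theorem dirDeriv_id (x : M) (v : E) : dirDeriv I I (fun y : M => y) x v = v := by
  change mfderiv I I (@id M) x v = v
  rw [mfderiv_id]
  rfl

variable {E'' : Type*} [NormedAddCommGroup E''] [NormedSpace ℝ E'']
  {B'' : Type*} [TopologicalSpace B''] {I'' : ModelWithCorners ℝ E'' B''}
  {M'' : Type*} [TopologicalSpace M''] [ChartedSpace B'' M'']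

theorem dirDeriv_comp {g : M' → M''} {f : M → M'} (hg : MDifferentiable I' I'' g)
    (hf : MDifferentiable I I' f) (x : M) (v : E) :
    dirDeriv I I'' (fun y => g (f y)) x v = dirDeriv I' I'' g (f x) (dirDeriv I I' f x v) :=
  mfderiv_comp_apply x (hg (f x)) (hf x) v

theorem dirDeriv_prodMk {f : M → M'} {g : M → M''} (hf : MDifferentiable I I' f)
    (hg : MDifferentiable I I'' g) (x : M) (v : E) :
    dirDeriv I (I'.prod I'') (fun y => (f y, g y)) x v =
      (dirDeriv I I' f x v, dirDeriv I I'' g x v) := by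
  unfold dirDeriv
  rw [mfderiv_prodMk (hf x) (hg x)]
  rfl

/-- The derivative of a function of two variables along a curve is the sum of the two partial
derivatives. -/
theorem dirDeriv_comp₂ {E₃ : Type*} [NormedAddCommGroup E₃] [NormedSpace ℝ E₃]
    {B₃ : Type*} [TopologicalSpace B₃] {I₃ : ModelWithCorners ℝ E₃ B₃}
    {M₃ : Type*} [TopologicalSpace M₃] [ChartedSpace B₃ M₃]
    {F : M' → M'' → M₃} (hF : MDifferentiable (I'.prod I'') I₃ (fun p : M' × M'' => F p.1 p.2))
    {f : M → M'} {g : M → M''} (hf : MDifferentiable I I' f)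
    (hg : MDifferentiable I I'' g) (x : M) (v : E) :
    dirDeriv I I₃ (fun y => F (f y) (g y)) x v =
      dirDeriv I' I₃ (fun a => F a (g x)) (f x) (dirDeriv I I' f x v) +
        dirDeriv I'' I₃ (fun b => F (f x) b) (g x) (dirDeriv I I'' g x v) := by
  rw [dirDeriv_comp (g := fun p : M' × M'' => F p.1 p.2) hF (hf.prodMk hg),
    dirDeriv_prodMk hf hg]
  exact mfderiv_prod_eq_add_apply (hF (f x, g x))

theorem trivializationAt_tangentVec [IsManifold I ∞ M] (x : M) (v : E) :
    (trivializationAt E (TangentSpace I : M → Type _) x (tangentVec I x v)).2 = v := by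
  have : IsManifold I 1 M := IsManifold.of_le (m := 1) (n := ∞) (by simp)
  exact tangentCoordChange_self (I := I) (x := x) (z := x) (v := v) (mem_extChartAt_source x)

/-- The inclusion of a single tangent space into the tangent bundle is smooth. -/
theorem contMDiff_tangentVec [IsManifold I ∞ M] (x : M) :
    ContMDiff 𝓘(ℝ, E) I.tangent ∞ (fun v : TangentSpace I x => tangentVec I x v) := by
  have : IsManifold I 1 M := IsManifold.of_le (m := 1) (n := ∞) (by simp)
  intro v
  rw [Bundle.contMDiffAt_totalSpace]
  refine ⟨contMDiffAt_const, ?_⟩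
  have h : ContMDiffAt 𝓘(ℝ, E) 𝓘(ℝ, E) ∞ (fun w : E => w) v := contMDiffAt_id
  exact h.congr_of_eventuallyEq
    (Filter.Eventually.of_forall fun w => trivializationAt_tangentVec x w)

/-- A smooth map into the tangent bundle with values in a single tangent space is smooth as a map
into that vector space. -/
theorem contMDiff_tangentVecPart_of_proj_eq [IsManifold I ∞ M] {f : M' → TangentBundle I M}
    (x : M) (hf : ContMDiff I' I.tangent ∞ f) (hx : ∀ n, (f n).proj = x) :
    ContMDiff I' 𝓘(ℝ, E) ∞ (fun n => (tangentVecPart (E := E) (f n) : TangentSpace I x)) := by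
  have : IsManifold I 1 M := IsManifold.of_le (m := 1) (n := ∞) (by simp)
  intro n
  have h := (Bundle.contMDiffAt_totalSpace.1 (hf n)).2
  refine h.congr_of_eventuallyEq (Filter.Eventually.of_forall fun k => ?_)
  have hk : tangentVec I (f n).proj (tangentVecPart (f k)) = f k := by
    rw [hx n, ← hx k, tangentVec_eta]
  exact (trivializationAt_tangentVec (f n).proj (tangentVecPart (f k))).symm.trans
    (congrArg (fun Z => (trivializationAt E (TangentSpace I : M → Type _) (f n).proj Z).2) hk)

end DirDeriv

/-! ### The tangent group of a Lie group -/

section LieGroup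
variable {E : Type*} [NormedAddCommGroup E] [NormedSpace ℝ E]
  {B : Type*} [TopologicalSpace B] {I : ModelWithCorners ℝ E B}
  {G : Type*} [TopologicalSpace G] [ChartedSpace B G] [Group G] [LieGroup I ∞ G]

theorem mdifferentiable_mul :
    MDifferentiable (I.prod I) I (fun p : G × G => p.1 * p.2) :=
  (contMDiff_mul I ∞).mdifferentiable (by simp)

theorem mdifferentiable_const_mul (g : G) : MDifferentiable I I (fun x : G => g * x) :=
  (contMDiff_mul_left (I := I) (n := ∞)).mdifferentiable (by simp)

theorem mdifferentiable_mul_const (g : G) : MDifferentiable I I (fun x : G => x * g) :=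
  (contMDiff_mul_right (I := I) (n := ∞)).mdifferentiable (by simp)

theorem tangentVec_mul_tangentVec (g h : G) (u w : E) :
    tangentVec I g u * tangentVec I h w =
      tangentVec I (g * h)
        (dirDeriv I I (fun x : G => x * h) g u + dirDeriv I I (fun x : G => g * x) h w) :=
  congrArg (tangentVec I (g * h))
    (mfderiv_prod_eq_add_apply (v := (u, w)) (mdifferentiable_mul (I := I) (g, h)))

theorem tangentBundle_one_def : (1 : TangentBundle I G) = tangentVec I 1 0 := rfl

theorem tangentMap_mul_tangentMap {E' : Type*} [NormedAddCommGroup E'] [NormedSpace ℝ E']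
    {B' : Type*} [TopologicalSpace B'] {I' : ModelWithCorners ℝ E' B'}
    {N : Type*} [TopologicalSpace N] [ChartedSpace B' N] {f g : N → G}
    (hf : MDifferentiable I' I f) (hg : MDifferentiable I' I g) (W : TangentBundle I' N) :
    tangentMap I' I f W * tangentMap I' I g W = tangentMap I' I (fun w => f w * g w) W :=
  tangentMul_tangentMap hf hg W

theorem tangentVec_zero_mul (g h : G) (w : E) :
    tangentVec I g 0 * tangentVec I h w =
      tangentVec I (g * h) (dirDeriv I I (fun x : G => g * x) h w) := by
  rw [tangentVec_mul_tangentVec, dirDeriv_zero, zero_add]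

theorem tangentVec_mul_zero (g h : G) (u : E) :
    tangentVec I g u * tangentVec I h 0 =
      tangentVec I (g * h) (dirDeriv I I (fun x : G => x * h) g u) := by
  rw [tangentVec_mul_tangentVec, dirDeriv_zero, add_zero]

theorem tangentVec_zero_mul_zero (g h : G) :
    tangentVec I g 0 * tangentVec I h 0 = tangentVec I (g * h) 0 := by
  rw [tangentVec_zero_mul, dirDeriv_zero]

theorem tangentVec_zero_inv (g : G) : (tangentVec I g 0)⁻¹ = tangentVec I g⁻¹ 0 := by
  rw [inv_eq_iff_mul_eq_one, tangentVec_zero_mul_zero, mul_inv_cancel, tangentBundle_one_def]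

theorem tangentVec_one_mul_one (u w : E) :
    tangentVec I (1 : G) u * tangentVec I 1 w = tangentVec I 1 (u + w) := by
  rw [tangentVec_mul_tangentVec]
  simp only [mul_one, one_mul, dirDeriv_id]

theorem leftTriv_symm_eq_mul (g : G) (ξ : E) :
    leftTriv.symm ((g, ξ) : G × E) = tangentVec I g 0 * tangentVec I 1 ξ := by
  have h := tangentVec_zero_mul (I := I) g 1 ξ
  rw [mul_one] at h
  exact h.symm

/-- Conjugating a vector of the Lie algebra by the zero vector over a group element differentiates
the inner automorphism. -/
theorem tangentVec_zero_inv_mul_mul (h : G) (ξ : E) :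
    tangentVec I h⁻¹ 0 * tangentVec I 1 ξ * tangentVec I h 0 =
      tangentVec I 1 (dirDeriv I I (fun x : G => h⁻¹ * x * h) 1 ξ) := by
  rw [tangentVec_zero_mul, tangentVec_mul_zero,
    dirDeriv_comp (g := fun y : G => y * h) (mdifferentiable_mul_const h)
      (mdifferentiable_const_mul h⁻¹)]
  simp only [mul_one, inv_mul_cancel]

/-- The multiplication of the tangent group in the left trivialization. -/
theorem leftTriv_symm_mul_leftTriv_symm (g h : G) (ξ ζ : E) :
    (leftTriv.symm ((g, ξ) : G × E) * leftTriv.symm ((h, ζ) : G × E) : TangentBundle I G) =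
      leftTriv.symm
        ((g * h, dirDeriv I I (fun x : G => h⁻¹ * x * h) 1 ξ + ζ) : G × E) := by
  refine Eq.trans ?_ (leftTriv_symm_eq_mul _ _).symm
  refine (congrArg₂ (· * ·) (leftTriv_symm_eq_mul g ξ) (leftTriv_symm_eq_mul h ζ)).trans ?_
  rw [← tangentVec_one_mul_one, ← tangentVec_zero_inv_mul_mul, ← tangentVec_zero_mul_zero,
    ← tangentVec_zero_inv]
  group

/-- Product rule for functions with values in a Lie group. -/
theorem dirDeriv_mul {E' : Type*} [NormedAddCommGroup E'] [NormedSpace ℝ E']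
    {B' : Type*} [TopologicalSpace B'] {I' : ModelWithCorners ℝ E' B'}
    {N : Type*} [TopologicalSpace N] [ChartedSpace B' N] {f g : N → G}
    (hf : MDifferentiable I' I f) (hg : MDifferentiable I' I g) (x : N) (v : E') :
    dirDeriv I' I (fun y => f y * g y) x v =
      dirDeriv I I (fun a => a * g x) (f x) (dirDeriv I' I f x v) +
        dirDeriv I I (fun b => f x * b) (g x) (dirDeriv I' I g x v) :=
  dirDeriv_comp₂ (F := fun a b => a * b) mdifferentiable_mul hf hg x v

/-- The zero section of the tangent group is smooth. -/
theorem contMDiff_mk_zero :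
    ContMDiff I I.tangent ∞ (fun g : G => tangentVec I g 0) :=
  contMDiff_zeroSection ℝ (TangentSpace I : G → Type _)

end LieGroup

/-! ### Matched pairs from factorizations of Lie groups -/

namespace CocycleMatchedPair

section FactorizationAlgebra
variable {M H K : Type*} [Group H] [Group K] {i : M → K} {j : H →* K} {e : M × H ≃ K}

/-- Uniqueness of the factorization `k = i x * j y`. -/
theorem eq_of_factorization (he : ∀ p, e p = i p.1 * j p.2) {k : K} {x : M} {y : H}
    (h : k = i x * j y) : e.symm k = (x, y) := by
  rw [e.symm_apply_eq, he, h]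

theorem factorization_spec (he : ∀ p, e p = i p.1 * j p.2) (k : K) :
    i (e.symm k).1 * j (e.symm k).2 = k := by
  rw [← he, e.apply_symm_apply]

theorem eq_and_eq_of_factorization (he : ∀ p, e p = i p.1 * j p.2) {x x' : M} {y y' : H}
    (h : i x * j y = i x' * j y') : x = x' ∧ y = y' :=
  Prod.mk.inj (e.injective (by rw [he, he]; exact h : e (x, y) = e (x', y')))

variable {act : H → M → M} {sig : H → M → H} {dot : M → M → M} {gam : M → M → H}

/-- Both sides are the factorization of `j y * i x₁ * i x₂`. -/
theorem factorization_act_dot (hs : ∀ y x, i (act y x) * j (sig y x) = j y * i x)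
    (hd : ∀ x₁ x₂, i (dot x₁ x₂) * j (gam x₁ x₂) = i x₁ * i x₂) (y : H) (x₁ x₂ : M) :
    i (act y (dot x₁ x₂)) * j (sig y (dot x₁ x₂) * gam x₁ x₂) =
      i (dot (act y x₁) (act (sig y x₁) x₂)) *
        j (gam (act y x₁) (act (sig y x₁) x₂) * sig (sig y x₁) x₂) := by
  calc _ = i (act y (dot x₁ x₂)) * j (sig y (dot x₁ x₂)) * j (gam x₁ x₂) := by
        rw [map_mul, mul_assoc]
    _ = j y * i x₁ * i x₂ := by rw [hs, mul_assoc, hd, mul_assoc]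
    _ = i (act y x₁) * (i (act (sig y x₁) x₂) * j (sig (sig y x₁) x₂)) := by
        rw [hs, ← mul_assoc, hs]
    _ = _ := by rw [map_mul, ← mul_assoc, ← mul_assoc, hd]

/-- Both sides are the factorization of `i x₁ * i x₂ * i x₃`. -/
theorem factorization_dot_assoc (hs : ∀ y x, i (act y x) * j (sig y x) = j y * i x)
    (hd : ∀ x₁ x₂, i (dot x₁ x₂) * j (gam x₁ x₂) = i x₁ * i x₂) (x₁ x₂ x₃ : M) :
    i (dot x₁ (dot x₂ x₃)) * j (gam x₁ (dot x₂ x₃) * gam x₂ x₃) =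
      i (dot (dot x₁ x₂) (act (gam x₁ x₂) x₃)) *
        j (gam (dot x₁ x₂) (act (gam x₁ x₂) x₃) * sig (gam x₁ x₂) x₃) := by
  calc _ = i (dot x₁ (dot x₂ x₃)) * j (gam x₁ (dot x₂ x₃)) * j (gam x₂ x₃) := by
        rw [map_mul, mul_assoc]
    _ = i x₁ * i x₂ * i x₃ := by rw [hd, mul_assoc, hd, mul_assoc]
    _ = i (dot x₁ x₂) * (i (act (gam x₁ x₂) x₃) * j (sig (gam x₁ x₂) x₃)) := by
        rw [hs, ← mul_assoc, hd]
    _ = _ := by rw [map_mul, ← mul_assoc, ← mul_assoc, hd]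

/-- Both sides are the factorization of `j y₁ * j y₂ * i x`. -/
theorem factorization_mul_act (hs : ∀ y x, i (act y x) * j (sig y x) = j y * i x)
    (y₁ y₂ : H) (x : M) :
    i (act (y₁ * y₂) x) * j (sig (y₁ * y₂) x) =
      i (act y₁ (act y₂ x)) * j (sig y₁ (act y₂ x) * sig y₂ x) := by
  rw [hs, map_mul, map_mul, mul_assoc, ← hs, ← mul_assoc, ← mul_assoc, hs]

end FactorizationAlgebra

section Factorization
variable {EM : Type*} [NormedAddCommGroup EM] [NormedSpace ℝ EM]
  {BM : Type*} [TopologicalSpace BM] {I : ModelWithCorners ℝ EM BM}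
  {EH : Type*} [NormedAddCommGroup EH] [NormedSpace ℝ EH]
  {BH : Type*} [TopologicalSpace BH] {J : ModelWithCorners ℝ EH BH}
  {M : Type*} [TopologicalSpace M] [ChartedSpace BM M] [IsManifold I ∞ M]
  {H : Type*} [TopologicalSpace H] [ChartedSpace BH H] [Group H] [LieGroup J ∞ H]
  {EK : Type*} [NormedAddCommGroup EK] [NormedSpace ℝ EK]
  {BK : Type*} [TopologicalSpace BK] {L : ModelWithCorners ℝ EK BK}
  {K : Type*} [TopologicalSpace K] [ChartedSpace BK K] [Group K] [LieGroup L ∞ K]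

/-- If every element of a Lie group `K` factors uniquely and smoothly as `i x * j y`, with `j` a
homomorphism from a Lie group `H` and `i` a map from a manifold `M`, then `(M, H)` is a cocycle
matched pair, whose structure maps are the two components of the factorizations of `j y * i x` and
of `i x₁ * i x₂`. -/
def ofFactorization (o : M) (i : M → K) (j : H →* K) (e : M × H ≃ K)
    (he : ∀ p, e p = i p.1 * j p.2) (hio : i o = 1) (hi : ContMDiff I L ∞ i)
    (hj : ContMDiff J L ∞ j) (hes : ContMDiff L (I.prod J) ∞ e.symm) :
    CocycleMatchedPair I J M H where
  o := o
  act y x := (e.symm (j y * i x)).1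
  sig y x := (e.symm (j y * i x)).2
  dot x₁ x₂ := (e.symm (i x₁ * i x₂)).1
  gam x₁ x₂ := (e.symm (i x₁ * i x₂)).2
  contMDiff_act := contMDiff_fst.comp
    (hes.comp ((hj.comp contMDiff_fst).mul (hi.comp contMDiff_snd)))
  contMDiff_sig := contMDiff_snd.comp
    (hes.comp ((hj.comp contMDiff_fst).mul (hi.comp contMDiff_snd)))
  contMDiff_dot := contMDiff_fst.comp
    (hes.comp ((hi.comp contMDiff_fst).mul (hi.comp contMDiff_snd)))
  contMDiff_gam := contMDiff_snd.comp
    (hes.comp ((hi.comp contMDiff_fst).mul (hi.comp contMDiff_snd)))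
  one_act x := by rw [eq_of_factorization he (x := x) (y := 1) (by simp)]
  mul_act y₁ y₂ x := (eq_and_eq_of_factorization he
    (factorization_mul_act (fun _ _ => factorization_spec he _) y₁ y₂ x)).1
  act_o y := by rw [eq_of_factorization he (x := o) (y := y) (by simp [hio])]
  sig_o y := by rw [eq_of_factorization he (x := o) (y := y) (by simp [hio])]
  one_sig x := by rw [eq_of_factorization he (x := x) (y := 1) (by simp)]
  o_dot x := by rw [eq_of_factorization he (x := x) (y := 1) (by simp [hio])]
  dot_o x := by rw [eq_of_factorization he (x := x) (y := 1) (by simp [hio])]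
  gam_o x := by rw [eq_of_factorization he (x := x) (y := 1) (by simp [hio])]
  o_gam x := by rw [eq_of_factorization he (x := x) (y := 1) (by simp [hio])]
  act_dot y x₁ x₂ := (eq_and_eq_of_factorization he (factorization_act_dot
    (fun _ _ => factorization_spec he _) (fun _ _ => factorization_spec he _) y x₁ x₂)).1
  sig_dot y x₁ x₂ := (eq_and_eq_of_factorization he (factorization_act_dot
    (fun _ _ => factorization_spec he _) (fun _ _ => factorization_spec he _) y x₁ x₂)).2
  mul_sig y₁ y₂ x := (eq_and_eq_of_factorization he
    (factorization_mul_act (fun _ _ => factorization_spec he _) y₁ y₂ x)).2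
  dot_assoc x₁ x₂ x₃ := (eq_and_eq_of_factorization he (factorization_dot_assoc
    (fun _ _ => factorization_spec he _) (fun _ _ => factorization_spec he _) x₁ x₂ x₃)).1
  gam_cocycle x₁ x₂ x₃ := (eq_and_eq_of_factorization he (factorization_dot_assoc
    (fun _ _ => factorization_spec he _) (fun _ _ => factorization_spec he _) x₁ x₂ x₃)).2
  exists_rightInv x := by
    set p := e.symm (i x)⁻¹ with hp
    have h : i p.1 * j p.2 = (i x)⁻¹ := by rw [← he, hp, e.apply_symm_apply]
    refine ⟨p.1, ?_⟩
    rw [eq_of_factorization he (x := o) (y := p.2⁻¹)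
      (by rw [hio, one_mul, map_inv, eq_inv_iff_mul_eq_one, mul_assoc, h, mul_inv_cancel])]

/-- The cocycle double cross product of the matched pair of a factorization of `K` is `K`. -/
def ofFactorizationMulEquiv (o : M) (i : M → K) (j : H →* K) (e : M × H ≃ K)
    (he : ∀ p, e p = i p.1 * j p.2) (hio : i o = 1) (hi : ContMDiff I L ∞ i)
    (hj : ContMDiff J L ∞ j) (hes : ContMDiff L (I.prod J) ∞ e.symm) :
    (ofFactorization o i j e he hio hi hj hes).Product ≃* K :=
  { e with
    map_mul' := by
      rintro ⟨x₁, y₁⟩ ⟨x₂, y₂⟩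
      set P := ofFactorization o i j e he hio hi hj hes
      have hs : ∀ y x, i (P.act y x) * j (P.sig y x) = j y * i x :=
        fun _ _ => factorization_spec he _
      have hd : ∀ x₁ x₂, i (P.dot x₁ x₂) * j (P.gam x₁ x₂) = i x₁ * i x₂ :=
        fun _ _ => factorization_spec he _
      change e (P.dot x₁ (P.act y₁ x₂), P.gam x₁ (P.act y₁ x₂) * P.sig y₁ x₂ * y₂) =
        e (x₁, y₁) * e (x₂, y₂)
      rw [he, he, he, map_mul, map_mul, ← mul_assoc, ← mul_assoc, hd, mul_assoc (i x₁), hs]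
      simp only [mul_assoc] }

end Factorization
end CocycleMatchedPair

/-! ### Tangent maps and products -/

section TangentProd
variable {E : Type*} [NormedAddCommGroup E] [NormedSpace ℝ E]
  {B : Type*} [TopologicalSpace B] {I : ModelWithCorners ℝ E B}
  {M : Type*} [TopologicalSpace M] [ChartedSpace B M]
  {E' : Type*} [NormedAddCommGroup E'] [NormedSpace ℝ E']
  {B' : Type*} [TopologicalSpace B'] {I' : ModelWithCorners ℝ E' B'}
  {M' : Type*} [TopologicalSpace M'] [ChartedSpace B' M']

/-- Two tangent vectors are the images of one tangent vector of the product. -/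
theorem exists_tangentMap_fst_snd (X : TangentBundle I M) (Y : TangentBundle I' M') :
    ∃ W : TangentBundle (I.prod I') (M × M'),
      tangentMap (I.prod I') I Prod.fst W = X ∧ tangentMap (I.prod I') I' Prod.snd W = Y := by
  refine ⟨(equivTangentBundleProd I M I' M').symm (X, Y), ?_, ?_⟩
  · rw [tangentMap_prodFst]; rfl
  · rw [tangentMap_prodSnd]; rfl

variable {E'' : Type*} [NormedAddCommGroup E''] [NormedSpace ℝ E'']
  {B'' : Type*} [TopologicalSpace B''] {I'' : ModelWithCorners ℝ E'' B''}
  {M'' : Type*} [TopologicalSpace M''] [ChartedSpace B'' M'']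

theorem tangentMap_tangentMap {g : M' → M''} {f : M → M'} (hg : MDifferentiable I' I'' g)
    (hf : MDifferentiable I I' f) (X : TangentBundle I M) :
    tangentMap I' I'' g (tangentMap I I' f X) = tangentMap I I'' (fun x => g (f x)) X :=
  (congrFun (tangentMap_comp hg hf) X).symm

theorem tangentMap_id_apply (X : TangentBundle I M) : tangentMap I I (fun x : M => x) X = X :=
  congrFun tangentMap_id X

end TangentProd

/-! ### Tangent maps of homomorphisms -/

section TangentHom
variable {E : Type*} [NormedAddCommGroup E] [NormedSpace ℝ E]
  {B : Type*} [TopologicalSpace B] {I : ModelWithCorners ℝ E B}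
  {G : Type*} [TopologicalSpace G] [ChartedSpace B G] [Group G] [LieGroup I ∞ G]
  {E' : Type*} [NormedAddCommGroup E'] [NormedSpace ℝ E']
  {B' : Type*} [TopologicalSpace B'] {I' : ModelWithCorners ℝ E' B'}
  {G' : Type*} [TopologicalSpace G'] [ChartedSpace B' G'] [Group G'] [LieGroup I' ∞ G']

/-- The tangent map of a differentiable group homomorphism, as a homomorphism of tangent groups. -/
noncomputable def tangentHom (φ : G →* G') (hφ : MDifferentiable I I' φ) :
    TangentBundle I G →* TangentBundle I' G' :=
  MonoidHom.mk' (tangentMap I I' φ) fun X Y => by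
    obtain ⟨W, rfl, rfl⟩ := exists_tangentMap_fst_snd X Y
    rw [tangentMap_mul_tangentMap mdifferentiable_fst mdifferentiable_snd,
      tangentMap_tangentMap hφ mdifferentiable_mul, tangentMap_tangentMap hφ mdifferentiable_fst,
      tangentMap_tangentMap hφ mdifferentiable_snd,
      tangentMap_mul_tangentMap (f := fun p : G × G => φ p.1) (g := fun p : G × G => φ p.2)
        (hφ.comp mdifferentiable_fst) (hφ.comp mdifferentiable_snd)]
    simp only [map_mul]

theorem tangentHom_apply (φ : G →* G') (hφ : MDifferentiable I I' φ) (X : TangentBundle I G) :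
    tangentHom φ hφ X = tangentMap I I' φ X := rfl

end TangentHom

/-! ### Factorization of the tangent group of a cocycle double cross product -/

namespace CocycleMatchedPair

variable {EM : Type*} [NormedAddCommGroup EM] [NormedSpace ℝ EM]
  {BM : Type*} [TopologicalSpace BM] {I : ModelWithCorners ℝ EM BM}
  {EH : Type*} [NormedAddCommGroup EH] [NormedSpace ℝ EH]
  {BH : Type*} [TopologicalSpace BH] {J : ModelWithCorners ℝ EH BH}
  {M : Type*} [TopologicalSpace M] [ChartedSpace BM M] [IsManifold I ∞ M]
  {H : Type*} [TopologicalSpace H] [ChartedSpace BH H] [Group H] [LieGroup J ∞ H]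

/-- The map `m ↦ (m, 1)` from `M` to `M ⋈_γ H`. -/
def inl (P : CocycleMatchedPair I J M H) (m : M) : P.Product := (m, 1)

/-- The embedding `h ↦ (o, h)` of the Lie group `H` in `M ⋈_γ H`. -/
noncomputable def inr (P : CocycleMatchedPair I J M H) : H →* P.Product :=
  MonoidHom.mk' (fun h => ((P.o, h) : M × H)) fun h₁ h₂ => by
    refine Prod.ext ?_ ?_
    · change P.o = P.dot P.o (P.act h₁ P.o)
      rw [P.act_o, P.dot_o]
    · change h₁ * h₂ = P.gam P.o (P.act h₁ P.o) * P.sig h₁ P.o * h₂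
      rw [P.act_o, P.gam_o, P.sig_o, one_mul]

/-- The projection of `M ⋈_γ H` to `M`. -/
def fstM (P : CocycleMatchedPair I J M H) (g : P.Product) : M := g.1

/-- The projection of `M ⋈_γ H` to `H`. -/
def sndH (P : CocycleMatchedPair I J M H) (g : P.Product) : H := g.2

variable (P : CocycleMatchedPair I J M H)

theorem contMDiff_inl : ContMDiff I (I.prod J) ∞ P.inl :=
  (contMDiff_id.prodMk contMDiff_const : ContMDiff I (I.prod J) ∞ fun m : M => (m, (1 : H)))

theorem contMDiff_inr : ContMDiff J (I.prod J) ∞ P.inr :=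
  (contMDiff_const.prodMk contMDiff_id : ContMDiff J (I.prod J) ∞ fun h : H => (P.o, h))

theorem contMDiff_fstM : ContMDiff (I.prod J) I ∞ P.fstM :=
  (contMDiff_fst : ContMDiff (I.prod J) I ∞ (Prod.fst : M × H → M))

theorem contMDiff_sndH : ContMDiff (I.prod J) J ∞ P.sndH :=
  (contMDiff_snd : ContMDiff (I.prod J) J ∞ (Prod.snd : M × H → H))

theorem mdifferentiable_inl : MDifferentiable I (I.prod J) P.inl :=
  P.contMDiff_inl.mdifferentiable (by simp)

theorem mdifferentiable_inr : MDifferentiable J (I.prod J) P.inr :=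
  P.contMDiff_inr.mdifferentiable (by simp)

theorem mdifferentiable_fstM : MDifferentiable (I.prod J) I P.fstM :=
  P.contMDiff_fstM.mdifferentiable (by simp)

theorem mdifferentiable_sndH : MDifferentiable (I.prod J) J P.sndH :=
  P.contMDiff_sndH.mdifferentiable (by simp)

theorem dirDeriv_inl (m : M) (v : EM) :
    dirDeriv I (I.prod J) P.inl m v = (v, 0) := by
  have h := dirDeriv_prodMk (I := I) (I' := I) (I'' := J) (f := fun n : M => n)
    (g := fun _ => (1 : H)) mdifferentiable_id mdifferentiable_const m v
  rw [dirDeriv_id, dirDeriv_const] at h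
  exact h

theorem dirDeriv_inr (y : H) (η : EH) :
    dirDeriv J (I.prod J) P.inr y η = (0, η) := by
  have h := dirDeriv_prodMk (I := J) (I' := I) (I'' := J) (f := fun _ : H => P.o)
    (g := fun n : H => n) mdifferentiable_const mdifferentiable_id y η
  rw [dirDeriv_id, dirDeriv_const] at h
  exact h

theorem dirDeriv_fstM (g : P.Product) (w : EM × EH) :
    dirDeriv (I.prod J) I P.fstM g w = w.1 :=
  DFunLike.congr_fun (mfderiv_fst (I := I) (I' := J) (x := (P.fstM g, P.sndH g))) w

theorem dirDeriv_sndH (g : P.Product) (w : EM × EH) :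
    dirDeriv (I.prod J) J P.sndH g w = w.2 :=
  DFunLike.congr_fun (mfderiv_snd (I := I) (I' := J) (x := (P.fstM g, P.sndH g))) w

theorem inl_o : P.inl P.o = 1 := rfl

theorem inl_mul_inr (m : M) (h : H) : P.inl m * P.inr h = ((m, h) : M × H) := by
  refine Prod.ext ?_ ?_
  · change P.dot m (P.act 1 P.o) = m
    rw [P.act_o, P.dot_o]
  · change P.gam m (P.act 1 P.o) * P.sig 1 P.o * h = h
    rw [P.act_o, P.gam_o, P.sig_o, one_mul, one_mul]

theorem inl_fstM_mul_inr_sndH (g : P.Product) : P.inl (P.fstM g) * P.inr (P.sndH g) = g :=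
  P.inl_mul_inr g.1 g.2

theorem inl_fstM_inv_mul (g : P.Product) : (P.inl (P.fstM g))⁻¹ * g = P.inr (P.sndH g) := by
  rw [inv_mul_eq_iff_eq_mul, P.inl_fstM_mul_inr_sndH]

theorem fstM_mul_inr (g : P.Product) (h : H) : P.fstM (g * P.inr h) = P.fstM g := by
  change P.dot g.1 (P.act g.2 P.o) = g.1
  rw [P.act_o, P.dot_o]

theorem inl_mul_inl (m n : M) : P.inl m * P.inl n = ((P.dot m n, P.gam m n) : M × H) := by
  refine Prod.ext ?_ ?_
  · change P.dot m (P.act 1 n) = _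
    rw [P.one_act]
  · change P.gam m (P.act 1 n) * P.sig 1 n * 1 = _
    rw [P.one_act, P.one_sig, mul_one, mul_one]

theorem inl_inv (m : M) :
    (P.inl m)⁻¹ = ((P.rInv m, (P.gam m (P.rInv m))⁻¹) : M × H) := by
  refine Prod.ext ?_ ?_
  · change P.act 1⁻¹ (P.rInv m) = _
    rw [inv_one, P.one_act]
  · change P.sig 1⁻¹ (P.rInv m) * _ = _
    rw [inv_one, P.one_sig, one_mul]
    rfl

theorem tangentMap_inl (v : EM) : tangentMap I (I.prod J) P.inl (tangentVec I P.o v) =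
    tangentVec (I.prod J) 1 (v, 0) := by
  rw [tangentMap_tangentVec, dirDeriv_inl, inl_o]

variable [CompleteSpace EM] [CompleteSpace EH] [I.Boundaryless] [J.Boundaryless]

/-- The map `inclM`, with the vector argument in the model space. -/
noncomputable def tangentInl (m : M) (v : EM) : TangentBundle (I.prod J) P.Product :=
  tangentVec (I.prod J) (P.inl m) 0 * tangentMap I (I.prod J) P.inl (tangentVec I P.o v)

theorem inclM_eq_tangentInl (x : M × TangentSpace I P.o) :
    P.inclM x = P.tangentInl x.1 x.2 := by
  have h := leftTriv_symm_eq_mul (I := I.prod J) (P.inl x.1) ((x.2, 0) : EM × EH)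
  refine Eq.trans h ?_
  exact congrArg (tangentVec (I.prod J) (P.inl x.1) 0 * ·) (P.tangentMap_inl x.2).symm

theorem inclTH_eq_tangentHom (Y : TangentBundle J H) :
    P.inclTH Y = tangentHom P.inr P.mdifferentiable_inr Y := by
  have key : ∀ (h : H) (η : EH),
      leftTriv.symm ((P.inr h, ((0, η) : EM × EH)) : P.Product × (EM × EH)) =
        tangentHom (I := J) (I' := I.prod J) P.inr P.mdifferentiable_inr
          (leftTriv.symm ((h, η) : H × EH)) := by
    intro h η
    refine (leftTriv_symm_eq_mul (I := I.prod J) (P.inr h) ((0, η) : EM × EH)).trans ?_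
    refine Eq.trans ?_ (congrArg (tangentHom P.inr P.mdifferentiable_inr)
      (leftTriv_symm_eq_mul (I := J) h η)).symm
    rw [map_mul, tangentHom_apply, tangentHom_apply, tangentMap_tangentVec, tangentMap_tangentVec,
      dirDeriv_zero, dirDeriv_inr, map_one]
  refine (key (leftTriv Y).1 (leftTriv Y).2).trans ?_
  exact congrArg (tangentHom P.inr P.mdifferentiable_inr) (leftTriv.symm_apply_apply Y)

theorem contMDiff_tangentInl :
    ContMDiff (I.prod 𝓘(ℝ, EM)) (I.prod J).tangent ∞
      (fun x : M × TangentSpace I P.o => P.tangentInl x.1 x.2) := by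
  have h1 : ContMDiff (I.prod 𝓘(ℝ, EM)) (I.prod J).tangent ∞
      (fun x : M × TangentSpace I P.o => tangentVec (I.prod J) (P.inl x.1) 0) :=
    contMDiff_mk_zero.comp (P.contMDiff_inl.comp contMDiff_fst)
  have h2 : ContMDiff (I.prod 𝓘(ℝ, EM)) (I.prod J).tangent ∞
      (fun x : M × TangentSpace I P.o =>
        tangentMap I (I.prod J) P.inl (tangentVec I P.o x.2)) :=
    (P.contMDiff_inl.contMDiff_tangentMap (m := ∞) (by simp)).comp
      ((contMDiff_tangentVec P.o).comp contMDiff_snd)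
  exact h1.mul h2

/-- Right translation by elements of the subgroup `H` does not change the projection to `M`. -/
theorem tangentMap_fstM_mul_tangentHom_inr (X : TangentBundle (I.prod J) P.Product)
    (Y : TangentBundle J H) :
    tangentMap (I.prod J) I P.fstM (X * tangentHom P.inr P.mdifferentiable_inr Y) =
      tangentMap (I.prod J) I P.fstM X := by
  obtain ⟨W, rfl, rfl⟩ := exists_tangentMap_fst_snd X Y
  rw [tangentHom_apply, tangentMap_tangentMap P.mdifferentiable_inr mdifferentiable_snd,
    tangentMap_mul_tangentMap (g := fun p : P.Product × H => P.inr p.2) mdifferentiable_fst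
      (P.mdifferentiable_inr.comp mdifferentiable_snd),
    tangentMap_tangentMap (f := fun p : P.Product × H => p.1 * P.inr p.2)
      P.mdifferentiable_fstM (mdifferentiable_mul.comp
      (mdifferentiable_fst.prodMk (P.mdifferentiable_inr.comp mdifferentiable_snd))),
    tangentMap_tangentMap P.mdifferentiable_fstM mdifferentiable_fst]
  simp only [fstM_mul_inr]

/-- The vector `v ∈ T_o M`, as a point of the tangent bundle, in the factorization
`X = tangentInl m v * tangentHom inr Y`, where `m` is the projection of the base point of `X`:
translate `X` by `(m, 1)⁻¹` and project to `M`. -/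
noncomputable def tangentFst (X : TangentBundle (I.prod J) P.Product) : TangentBundle I M :=
  tangentMap (I.prod J) I P.fstM ((tangentVec (I.prod J) (P.inl (P.fstM X.proj)) 0)⁻¹ * X)

theorem tangentFst_proj (X : TangentBundle (I.prod J) P.Product) :
    (P.tangentFst X).proj = P.o := by
  change P.fstM ((P.inl (P.fstM X.proj))⁻¹ * X.proj) = P.o
  rw [inl_fstM_inv_mul]
  rfl

theorem contMDiff_tangentFst : ContMDiff (I.prod J).tangent I.tangent ∞ P.tangentFst := by
  have h1 : ContMDiff (I.prod J).tangent (I.prod J).tangent ∞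
      (fun X : TangentBundle (I.prod J) P.Product =>
        tangentVec (I.prod J) (P.inl (P.fstM X.proj)) 0) :=
    contMDiff_mk_zero.comp (P.contMDiff_inl.comp (P.contMDiff_fstM.comp
      (Bundle.contMDiff_proj (TangentSpace (I.prod J) : P.Product → Type _))))
  exact (P.contMDiff_fstM.contMDiff_tangentMap (m := ∞) (by simp)).comp (h1.inv.mul contMDiff_id)

theorem tangentFst_tangentInl_mul (m : M) (v : EM) (Y : TangentBundle J H) :
    P.tangentFst (P.tangentInl m v * tangentHom P.inr P.mdifferentiable_inr Y) =
      tangentVec I P.o v := by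
  have h : P.fstM (P.tangentInl m v * tangentHom P.inr P.mdifferentiable_inr Y).proj = m := by
    change P.fstM (P.inl m * 1 * P.inr Y.proj) = m
    rw [fstM_mul_inr, mul_one]
    rfl
  rw [tangentFst, h, tangentInl, mul_assoc, inv_mul_cancel_left,
    tangentMap_fstM_mul_tangentHom_inr, tangentMap_inl, tangentMap_tangentVec, dirDeriv_fstM]
  rfl

/-- The quotient of `X` by its `M`-part is tangent to the subgroup `H`. -/
theorem tangentHom_inr_tangentMap_sndH (X : TangentBundle (I.prod J) P.Product) :
    tangentHom P.inr P.mdifferentiable_inr (tangentMap (I.prod J) J P.sndH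
      ((P.tangentInl (P.fstM X.proj) (tangentVecPart (P.tangentFst X)))⁻¹ * X)) =
      (P.tangentInl (P.fstM X.proj) (tangentVecPart (P.tangentFst X)))⁻¹ * X := by
  set v := tangentVecPart (P.tangentFst X) with hv
  set Z := (P.tangentInl (P.fstM X.proj) v)⁻¹ * X with hZ
  set z : EM × EH := tangentVecPart Z with hz
  set h := P.sndH X.proj with hh
  have hZproj : Z.proj = P.inr h := by
    change (P.inl (P.fstM X.proj) * 1)⁻¹ * X.proj = _
    rw [mul_one, inl_fstM_inv_mul]
  have hZz : Z = tangentVec (I.prod J) (P.inr h) z := by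
    rw [hz, ← hZproj, tangentVec_eta]
  have hX : (tangentVec (I.prod J) (P.inl (P.fstM X.proj)) 0)⁻¹ * X =
      tangentVec (I.prod J) 1 (v, 0) * Z := by
    rw [hZ, tangentInl, tangentMap_inl, mul_inv_rev, mul_assoc, mul_inv_cancel_left]
  have hz1 : z.1 = 0 := by
    have h1 : P.tangentFst X = tangentVec I P.o (v + z.1) := by
      rw [tangentFst, hX, hZz, tangentVec_mul_tangentVec, tangentMap_tangentVec, dirDeriv_add,
        ← dirDeriv_comp P.mdifferentiable_fstM (mdifferentiable_mul_const _)]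
      simp only [fstM_mul_inr, one_mul, dirDeriv_id]
      have h2 := P.dirDeriv_fstM (1 : P.Product) ((v, 0) : EM × EH)
      have h3 := P.dirDeriv_fstM (P.inr h) z
      refine congrArg₂ (tangentVec I) rfl (congrArg₂ (· + ·) h2 h3)
    have h4 : v = v + z.1 := by
      conv_lhs => rw [hv, h1, tangentVecPart_tangentVec]
    exact left_eq_add.1 h4
  rw [hZz, tangentHom_apply, tangentMap_tangentVec, tangentMap_tangentVec, dirDeriv_sndH,
    dirDeriv_inr]
  exact congrArg₂ (tangentVec (I.prod J)) rfl (Prod.ext hz1.symm rfl)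

/-- The factorization of the tangent group `T(M ⋈_γ H)` as the product of `M × T_o M` and the
subgroup `TH`. -/
noncomputable def tangentFactorization :
    (M × TangentSpace I P.o) × TangentBundle J H ≃ TangentBundle (I.prod J) P.Product where
  toFun p := P.tangentInl p.1.1 p.1.2 * tangentHom P.inr P.mdifferentiable_inr p.2
  invFun X := ((P.fstM X.proj, tangentVecPart (E := EM) (P.tangentFst X)),
    tangentMap (I.prod J) J P.sndH
      ((P.tangentInl (P.fstM X.proj) (tangentVecPart (P.tangentFst X)))⁻¹ * X))
  left_inv := by
    rintro ⟨⟨m, (v : EM)⟩, Y⟩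
    have h1 : P.fstM (P.tangentInl m v * tangentHom P.inr P.mdifferentiable_inr Y).proj = m := by
      change P.fstM (P.inl m * 1 * P.inr Y.proj) = m
      rw [fstM_mul_inr, mul_one]
      rfl
    have h2 : tangentVecPart (P.tangentFst (P.tangentInl m v *
        tangentHom P.inr P.mdifferentiable_inr Y)) = v :=
      congrArg tangentVecPart (P.tangentFst_tangentInl_mul m v Y)
    refine Prod.ext (Prod.ext h1 h2) ?_
    dsimp only
    rw [h1, h2, inv_mul_cancel_left, tangentHom_apply,
      tangentMap_tangentMap P.mdifferentiable_sndH P.mdifferentiable_inr]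
    exact tangentMap_id_apply Y
  right_inv X := by
    dsimp only
    rw [tangentHom_inr_tangentMap_sndH, mul_inv_cancel_left]

theorem contMDiff_tangentFactorization :
    ContMDiff ((I.prod 𝓘(ℝ, EM)).prod J.tangent) (I.prod J).tangent ∞
      P.tangentFactorization :=
  (P.contMDiff_tangentInl.comp contMDiff_fst).mul
    ((P.contMDiff_inr.contMDiff_tangentMap (m := ∞) (by simp)).comp contMDiff_snd)

theorem contMDiff_tangentFactorization_symm :
    ContMDiff (I.prod J).tangent ((I.prod 𝓘(ℝ, EM)).prod J.tangent) ∞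
      P.tangentFactorization.symm := by
  have h1 : ContMDiff (I.prod J).tangent (I.prod 𝓘(ℝ, EM)) ∞
      (fun X : TangentBundle (I.prod J) P.Product =>
        ((P.fstM X.proj, tangentVecPart (E := EM) (P.tangentFst X)) :
          M × TangentSpace I P.o)) :=
    (P.contMDiff_fstM.comp
      (Bundle.contMDiff_proj (TangentSpace (I.prod J) : P.Product → Type _))).prodMk
      (contMDiff_tangentVecPart_of_proj_eq P.o P.contMDiff_tangentFst P.tangentFst_proj)
  exact h1.prodMk ((P.contMDiff_sndH.contMDiff_tangentMap (m := ∞) (by simp)).comp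
    ((P.contMDiff_tangentInl.comp h1).inv.mul contMDiff_id))

end CocycleMatchedPair

/-! ### Adjoint action and the twisted cocycle -/

namespace CocycleMatchedPair

variable {EM : Type*} [NormedAddCommGroup EM] [NormedSpace ℝ EM]
  {BM : Type*} [TopologicalSpace BM] {I : ModelWithCorners ℝ EM BM}
  {EH : Type*} [NormedAddCommGroup EH] [NormedSpace ℝ EH]
  {BH : Type*} [TopologicalSpace BH] {J : ModelWithCorners ℝ EH BH}
  {M : Type*} [TopologicalSpace M] [ChartedSpace BM M] [IsManifold I ∞ M]
  {H : Type*} [TopologicalSpace H] [ChartedSpace BH H] [Group H] [LieGroup J ∞ H]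

variable (P : CocycleMatchedPair I J M H)

theorem mdifferentiable_act : MDifferentiable (J.prod I) I (fun p : H × M => P.act p.1 p.2) :=
  P.contMDiff_act.mdifferentiable (by simp)

theorem mdifferentiable_sig : MDifferentiable (J.prod I) J (fun p : H × M => P.sig p.1 p.2) :=
  P.contMDiff_sig.mdifferentiable (by simp)

theorem mdifferentiable_dot : MDifferentiable (I.prod I) I (fun p : M × M => P.dot p.1 p.2) :=
  P.contMDiff_dot.mdifferentiable (by simp)

theorem mdifferentiable_gam : MDifferentiable (I.prod I) J (fun p : M × M => P.gam p.1 p.2) :=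
  P.contMDiff_gam.mdifferentiable (by simp)

theorem mdifferentiable_act_right (h : H) : MDifferentiable I I (fun n => P.act h n) :=
  P.mdifferentiable_act.comp (mdifferentiable_const.prodMk mdifferentiable_id)

theorem mdifferentiable_act_left (m : M) : MDifferentiable J I (fun h => P.act h m) :=
  P.mdifferentiable_act.comp (mdifferentiable_id.prodMk mdifferentiable_const)

theorem mdifferentiable_sig_right (h : H) : MDifferentiable I J (fun n => P.sig h n) :=
  P.mdifferentiable_sig.comp (mdifferentiable_const.prodMk mdifferentiable_id)

theorem mdifferentiable_sig_left (m : M) : MDifferentiable J J (fun h => P.sig h m) :=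
  P.mdifferentiable_sig.comp (mdifferentiable_id.prodMk mdifferentiable_const)

theorem mdifferentiable_dot_right (m : M) : MDifferentiable I I (fun n => P.dot m n) :=
  P.mdifferentiable_dot.comp (mdifferentiable_const.prodMk mdifferentiable_id)

theorem mdifferentiable_dot_left (m : M) : MDifferentiable I I (fun n => P.dot n m) :=
  P.mdifferentiable_dot.comp (mdifferentiable_id.prodMk mdifferentiable_const)

theorem mdifferentiable_gam_right (m : M) : MDifferentiable I J (fun n => P.gam m n) :=
  P.mdifferentiable_gam.comp (mdifferentiable_const.prodMk mdifferentiable_id)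

/-- Conjugation by `(m, 1)⁻¹`, on the image of `M`. The second component is rewritten by means of
the compatibility of `sig` with `dot`. -/
theorem inl_inv_mul_inl_mul_inl (m n : M) :
    (P.inl m)⁻¹ * P.inl n * P.inl m =
      ((P.dot (P.rInv m) (P.act (P.gam m (P.rInv m))⁻¹ (P.dot n m)),
        P.gam (P.rInv m) (P.act (P.gam m (P.rInv m))⁻¹ (P.dot n m)) *
          (P.gam (P.act (P.gam m (P.rInv m))⁻¹ n)
              (P.act (P.sig (P.gam m (P.rInv m))⁻¹ n) m) *
            P.sig (P.sig (P.gam m (P.rInv m))⁻¹ n) m)) : M × H) := by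
  rw [mul_assoc, inl_mul_inl, inl_inv, ← P.sig_dot, ← mul_assoc]
  rfl

theorem inr_inv_mul_inl_mul_inr (h : H) (n : M) :
    (P.inr h)⁻¹ * P.inl n * P.inr h = ((P.act h⁻¹ n, P.sig h⁻¹ n * h) : M × H) := by
  rw [mul_assoc, inl_mul_inr, ← map_inv]
  refine Prod.ext ?_ ?_
  · exact P.o_dot _
  · change P.gam P.o (P.act h⁻¹ n) * P.sig h⁻¹ n * h = _
    rw [P.o_gam, one_mul]

theorem adM_eq (m : M) (v : EM) :
    dirDeriv I I (fun n => P.dot (P.rInv m) (P.act (P.gam m (P.rInv m))⁻¹ (P.dot n m))) P.o v =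
      P.adM m v := by
  set r := P.rInv m with hr
  set A := (P.gam m r)⁻¹ with hA
  change _ = dirDeriv I I (fun n => P.dot r n) (P.act A m)
    (dirDeriv I I (fun n => P.act A n) m (dirDeriv I I (fun n => P.dot n m) P.o v))
  rw [dirDeriv_comp (f := fun n => P.act A (P.dot n m)) (P.mdifferentiable_dot_right r)
      ((P.mdifferentiable_act_right A).comp (P.mdifferentiable_dot_left m)),
    dirDeriv_comp (P.mdifferentiable_act_right A) (P.mdifferentiable_dot_left m), P.o_dot]

theorem adH_eq (m : M) (v : EM) :
    dirDeriv I J (fun n => P.gam (P.rInv m) (P.act (P.gam m (P.rInv m))⁻¹ (P.dot n m)) *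
          (P.gam (P.act (P.gam m (P.rInv m))⁻¹ n)
              (P.act (P.sig (P.gam m (P.rInv m))⁻¹ n) m) *
            P.sig (P.sig (P.gam m (P.rInv m))⁻¹ n) m)) P.o v =
      P.adH m v := by
  set r := P.rInv m with hr
  set A := (P.gam m r)⁻¹ with hA
  change _ = dirDeriv J J (fun h => h * P.sig A m) (P.gam r (P.act A m))
      (dirDeriv I J (fun n => P.gam r n) (P.act A m)
          (dirDeriv I I (fun n => P.act A n) m (dirDeriv I I (fun n => P.dot n m) P.o v)) +
        dirDeriv J J (fun h => P.gam r (P.act A m) * h) 1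
          (dirDeriv I J (fun n => P.gam n (P.act A m)) P.o
            (dirDeriv I I (fun n => P.act A n) P.o v))) +
    dirDeriv J J (fun h => P.gam r (P.act A m) * h) (P.sig A m)
      (dirDeriv J J (fun h => P.sig h m) A (dirDeriv I J (fun n => P.sig A n) P.o v))
  have d₁ : MDifferentiable I I (fun n => P.act A (P.dot n m)) :=
    (P.mdifferentiable_act_right A).comp (P.mdifferentiable_dot_left m)
  have d₂ : MDifferentiable I J (fun n => P.gam r (P.act A (P.dot n m))) :=
    (P.mdifferentiable_gam_right r).comp d₁
  have d₃ : MDifferentiable I I (fun n => P.act (P.sig A n) m) :=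
    (P.mdifferentiable_act_left m).comp (P.mdifferentiable_sig_right A)
  have d₄ : MDifferentiable I J (fun n => P.gam (P.act A n) (P.act (P.sig A n) m)) :=
    P.mdifferentiable_gam.comp ((P.mdifferentiable_act_right A).prodMk d₃)
  have d₅ : MDifferentiable I J (fun n => P.sig (P.sig A n) m) :=
    (P.mdifferentiable_sig_left m).comp (P.mdifferentiable_sig_right A)
  have e₁ : dirDeriv I J (fun n => P.gam r (P.act A (P.dot n m))) P.o v =
      dirDeriv I J (fun n => P.gam r n) (P.act A m)
        (dirDeriv I I (fun n => P.act A n) m (dirDeriv I I (fun n => P.dot n m) P.o v)) := by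
    rw [dirDeriv_comp (P.mdifferentiable_gam_right r) d₁,
      dirDeriv_comp (P.mdifferentiable_act_right A) (P.mdifferentiable_dot_left m), P.o_dot]
  -- The derivative through the second slot of `gam` vanishes, since `gam o` is constant.
  have e₂ : dirDeriv I J (fun n => P.gam (P.act A n) (P.act (P.sig A n) m)) P.o v =
      dirDeriv I J (fun n => P.gam n (P.act A m)) P.o
        (dirDeriv I I (fun n => P.act A n) P.o v) := by
    rw [dirDeriv_comp₂ P.mdifferentiable_gam (P.mdifferentiable_act_right A) d₃]
    simp only [P.act_o, P.sig_o, P.o_gam, dirDeriv_const, add_zero]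
  have e₃ : dirDeriv I J (fun n => P.sig (P.sig A n) m) P.o v =
      dirDeriv J J (fun h => P.sig h m) A (dirDeriv I J (fun n => P.sig A n) P.o v) := by
    rw [dirDeriv_comp (P.mdifferentiable_sig_left m) (P.mdifferentiable_sig_right A), P.sig_o]
  have d₆ : MDifferentiable I J
      (fun n => P.gam (P.act A n) (P.act (P.sig A n) m) * P.sig (P.sig A n) m) :=
    mdifferentiable_mul.comp (d₄.prodMk d₅)
  rw [dirDeriv_mul d₂ d₆, dirDeriv_mul d₄ d₅, e₁, e₂, e₃]
  simp only [P.act_o, P.sig_o, P.o_gam, P.o_dot, one_mul, dirDeriv_id, dirDeriv_add]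
  -- Left and right translations commute.
  have comm : ∀ (g s : H) (u : EH),
      dirDeriv J J (fun h => g * h) s (dirDeriv J J (fun h => h * s) 1 u) =
        dirDeriv J J (fun h => h * s) g (dirDeriv J J (fun h => g * h) 1 u) := by
    intro g s u
    have h₁ := dirDeriv_comp (mdifferentiable_const_mul (I := J) g)
      (mdifferentiable_mul_const (I := J) s) 1 u
    have h₂ := dirDeriv_comp (mdifferentiable_mul_const (I := J) s)
      (mdifferentiable_const_mul (I := J) g) 1 u
    rw [one_mul] at h₁
    rw [mul_one] at h₂
    rw [← h₁, ← h₂]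
    simp only [mul_assoc]
  rw [comm, ← add_assoc]

/-- The derivative of the identity `sig h⁻¹ (act h n) * sig h n = 1` at `n = o`. -/
theorem dirDeriv_sig_inv_add_dirDeriv_sig (h : H) (w : EM) :
    dirDeriv J J (fun x => x * h) h⁻¹
        (dirDeriv I J (fun n => P.sig h⁻¹ n) P.o (dirDeriv I I (fun n => P.act h n) P.o w)) +
      dirDeriv J J (fun x => h⁻¹ * x) h (dirDeriv I J (fun n => P.sig h n) P.o w) = 0 := by
  have d : MDifferentiable I J (fun n => P.sig h⁻¹ (P.act h n)) :=
    (P.mdifferentiable_sig_right h⁻¹).comp (P.mdifferentiable_act_right h)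
  have h₁ := dirDeriv_mul d (P.mdifferentiable_sig_right h) P.o w
  rw [dirDeriv_comp (P.mdifferentiable_sig_right h⁻¹) (P.mdifferentiable_act_right h)] at h₁
  simp only [← P.mul_sig, inv_mul_cancel, P.one_sig, P.act_o, P.sig_o, dirDeriv_const] at h₁
  exact h₁.symm

theorem dirDeriv_act_inv_act (h : H) (w : EM) :
    dirDeriv I I (fun n => P.act h⁻¹ n) P.o (dirDeriv I I (fun n => P.act h n) P.o w) = w := by
  have h₁ := dirDeriv_comp (P.mdifferentiable_act_right h⁻¹) (P.mdifferentiable_act_right h) P.o w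
  simp only [← P.mul_act, inv_mul_cancel, P.one_act, P.act_o, dirDeriv_id] at h₁
  exact h₁.symm

variable [CompleteSpace EM] [CompleteSpace EH] [I.Boundaryless] [J.Boundaryless]

theorem mdifferentiable_conj (k : P.Product) :
    MDifferentiable (I.prod J) (I.prod J) (fun g : P.Product => k⁻¹ * g * k) :=
  (mdifferentiable_mul_const k).comp (mdifferentiable_const_mul k⁻¹)

/-- The adjoint action of `(m, 1)⁻¹` on `T_o M`. -/
theorem dirDeriv_conj_inl (m : M) (v : EM) :
    dirDeriv (I.prod J) (I.prod J) (fun g : P.Product => (P.inl m)⁻¹ * g * P.inl m) 1 (v, 0) =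
      ((P.adM m v, P.adH m v) : EM × EH) := by
  have h := dirDeriv_comp (P.mdifferentiable_conj (P.inl m)) P.mdifferentiable_inl P.o v
  rw [dirDeriv_inl, inl_o] at h
  refine h.symm.trans ?_
  rw [funext (P.inl_inv_mul_inl_mul_inl m)]
  set r := P.rInv m
  set A := (P.gam m r)⁻¹
  have d₁ : MDifferentiable I I (fun n => P.act A (P.dot n m)) :=
    (P.mdifferentiable_act_right A).comp (P.mdifferentiable_dot_left m)
  have d₂ : MDifferentiable I J (fun n => P.gam (P.act A n) (P.act (P.sig A n) m)) :=
    P.mdifferentiable_gam.comp ((P.mdifferentiable_act_right A).prodMk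
      ((P.mdifferentiable_act_left m).comp (P.mdifferentiable_sig_right A)))
  refine (dirDeriv_prodMk ((P.mdifferentiable_dot_right r).comp d₁)
    (mdifferentiable_mul.comp (((P.mdifferentiable_gam_right r).comp d₁).prodMk
      (mdifferentiable_mul.comp (d₂.prodMk
        ((P.mdifferentiable_sig_left m).comp (P.mdifferentiable_sig_right A)))))) P.o v).trans ?_
  exact Prod.ext (P.adM_eq m v) (P.adH_eq m v)

/-- The adjoint action of `(o, h)⁻¹` on `T_o M`. -/
theorem dirDeriv_conj_inr (h : H) (v : EM) :
    dirDeriv (I.prod J) (I.prod J) (fun g : P.Product => (P.inr h)⁻¹ * g * P.inr h) 1 (v, 0) =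
      (dirDeriv I I (fun n => P.act h⁻¹ n) P.o v,
        dirDeriv J J (fun x => x * h) h⁻¹ (dirDeriv I J (fun n => P.sig h⁻¹ n) P.o v)) := by
  have h₁ := dirDeriv_comp (P.mdifferentiable_conj (P.inr h)) P.mdifferentiable_inl P.o v
  rw [dirDeriv_inl, inl_o] at h₁
  refine h₁.symm.trans ?_
  rw [funext (P.inr_inv_mul_inl_mul_inr h)]
  have d := (mdifferentiable_mul_const h).comp (P.mdifferentiable_sig_right h⁻¹)
  refine (dirDeriv_prodMk (P.mdifferentiable_act_right h⁻¹) d P.o v).trans ?_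
  refine congrArg (Prod.mk _) ?_
  refine (dirDeriv_comp (mdifferentiable_mul_const h)
    (P.mdifferentiable_sig_right h⁻¹) P.o v).trans ?_
  rw [P.sig_o]

/-- The product `i(m₁, v₁) * i(m₂, v₂)` in the left trivialization. -/
theorem inclM_mul_inclM (x y : M × TangentSpace I P.o) :
    P.inclM x * P.inclM y = (leftTriv (I := I.prod J) (G := P.Product)).symm (((P.dot x.1 y.1, P.gam x.1 y.1) : M × H),
      ((y.2 + P.adM y.1 x.2, P.adH y.1 x.2) : EM × EH)) := by
  refine (leftTriv_symm_mul_leftTriv_symm (I := I.prod J) (P.inl x.1) (P.inl y.1)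
    ((x.2, 0) : EM × EH) ((y.2, 0) : EM × EH)).trans ?_
  refine congrArg (leftTriv (I := I.prod J) (G := P.Product)).symm
    (Prod.ext (P.inl_mul_inl x.1 y.1) ?_)
  refine (congrArg (· + ((y.2, 0) : EM × EH)) (P.dirDeriv_conj_inl y.1 x.2)).trans ?_
  exact Prod.ext (add_comm (P.adM y.1 x.2) y.2) (add_zero (P.adH y.1 x.2))

/-- The factorization of `i(m₁, v₁) * i(m₂, v₂)`, whose component in `TH` is `Λ`. -/
theorem inclM_mul_inclM_eq_inclM_mul_inclTH (x y : M × TangentSpace I P.o) :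
    P.inclM x * P.inclM y =
      P.inclM (P.dot x.1 y.1, dirDeriv (E' := EM) I I (fun n => P.act (P.gam x.1 y.1) n) P.o
        (y.2 + P.adM y.1 x.2)) * P.inclTH (P.Lam x y) := by
  rw [inclM_mul_inclM]
  set h := P.gam x.1 y.1 with hh
  set w : TangentSpace I P.o := y.2 + P.adM y.1 x.2 with hw
  have hL : leftTriv (P.Lam x y) = (h, P.adH y.1 x.2 + P.sigLog h w) :=
    leftTriv.apply_symm_apply _
  unfold inclTH
  rw [hL]
  refine Eq.symm ((leftTriv_symm_mul_leftTriv_symm (I := I.prod J) (P.inl (P.dot x.1 y.1))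
    (P.inr h) ((dirDeriv I I (fun n => P.act h n) P.o w, 0) : EM × EH)
    ((0, P.adH y.1 x.2 + P.sigLog h w) : EM × EH)).trans ?_)
  refine congrArg (leftTriv (I := I.prod J) (G := P.Product)).symm
    (Prod.ext (P.inl_mul_inr _ h) ?_)
  refine (congrArg (· + ((0, P.adH y.1 x.2 + P.sigLog h w) : EM × EH))
    (P.dirDeriv_conj_inr h _)).trans (Prod.ext ?_ ?_)
  · exact (add_zero _).trans (P.dirDeriv_act_inv_act h w)
  · have key : ∀ a b c : EH, a + c = 0 → a + (b + c) = b := by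
      intro a b c hac
      rw [add_left_comm, hac, add_zero]
    exact key _ _ _ (P.dirDeriv_sig_inv_add_dirDeriv_sig h w)

end CocycleMatchedPair

theorem mainTheorem1
    {EM : Type*} [NormedAddCommGroup EM] [NormedSpace ℝ EM] [CompleteSpace EM]
    {BM : Type*} [TopologicalSpace BM] (I : ModelWithCorners ℝ EM BM) [I.Boundaryless]
    {EH : Type*} [NormedAddCommGroup EH] [NormedSpace ℝ EH] [CompleteSpace EH]
    {BH : Type*} [TopologicalSpace BH] (J : ModelWithCorners ℝ EH BH) [J.Boundaryless]
    {M : Type*} [TopologicalSpace M] [ChartedSpace BM M] [IsManifold I ∞ M]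
    {H : Type*} [TopologicalSpace H] [ChartedSpace BH H] [Group H] [LieGroup J ∞ H]
    (P : CocycleMatchedPair I J M H) :
    ∃ Q : CocycleMatchedPair (I.prod 𝓘(ℝ, EM)) J.tangent
        (M × TangentSpace I P.o) (TangentBundle J H),
      Q.o = (P.o, 0) ∧
      (∀ x y, Q.gam x y = P.Lam x y) ∧
      (∃ Ψ : Q.Product ≃* TangentBundle (I.prod J) P.Product,
        ContMDiff ((I.prod 𝓘(ℝ, EM)).prod J.tangent) (I.prod J).tangent ∞ Ψ ∧
        ContMDiff (I.prod J).tangent ((I.prod 𝓘(ℝ, EM)).prod J.tangent) ∞ Ψ.symm ∧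
        ∀ (x : M × TangentSpace I P.o) (Y : TangentBundle J H),
          Ψ ((x, Y) : (M × TangentSpace I P.o) × TangentBundle J H) = P.inclM x * P.inclTH Y) ∧
      (∃ j : TangentBundle J H →* TangentBundle (I.prod J) P.Product,
        Function.Injective j ∧ ContMDiff J.tangent (I.prod J).tangent ∞ j ∧
        ∀ Y, j Y = P.inclTH Y) ∧
      (∀ x y : M × TangentSpace I P.o,
        leftTriv (P.inclM x * P.inclM y) =
          (((P.dot x.1 y.1, P.gam x.1 y.1) : M × H),
            ((y.2 + P.adM y.1 x.2, P.adH y.1 x.2) : EM × EH))) := by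
  have he : ∀ p, P.tangentFactorization p =
      P.inclM p.1 * tangentHom P.inr P.mdifferentiable_inr p.2 := fun p => by
    rw [P.inclM_eq_tangentInl]
    rfl
  have ho : P.inclM (P.o, 0) = 1 := by
    rw [P.inclM_eq_tangentInl]
    change P.tangentInl P.o (0 : EM) = 1
    rw [CocycleMatchedPair.tangentInl, P.tangentMap_inl, P.inl_o]
    exact one_mul 1
  have hi : ContMDiff (I.prod 𝓘(ℝ, EM)) (I.prod J).tangent ∞ P.inclM := by
    rw [funext P.inclM_eq_tangentInl]
    exact P.contMDiff_tangentInl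
  have hj : ContMDiff J.tangent (I.prod J).tangent ∞
      (tangentHom P.inr P.mdifferentiable_inr) :=
    P.contMDiff_inr.contMDiff_tangentMap (m := ∞) (by simp)
  have hj_inj : Function.Injective (tangentHom P.inr P.mdifferentiable_inr) := fun Y Z h =>
    congrArg Prod.snd (P.tangentFactorization.injective
      (show P.tangentFactorization ((P.o, 0), Y) = P.tangentFactorization ((P.o, 0), Z) by
        rw [he, he, h]))
  refine ⟨CocycleMatchedPair.ofFactorization (P.o, 0) P.inclM
      (tangentHom P.inr P.mdifferentiable_inr) P.tangentFactorization he ho hi hj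
      P.contMDiff_tangentFactorization_symm, rfl, fun x y => ?_,
    ⟨CocycleMatchedPair.ofFactorizationMulEquiv (P.o, 0) P.inclM
      (tangentHom P.inr P.mdifferentiable_inr) P.tangentFactorization he ho hi hj
      P.contMDiff_tangentFactorization_symm, P.contMDiff_tangentFactorization,
      P.contMDiff_tangentFactorization_symm, fun x Y => ?_⟩,
    ⟨tangentHom P.inr P.mdifferentiable_inr, hj_inj, hj,
      fun Y => (P.inclTH_eq_tangentHom Y).symm⟩, fun x y => ?_⟩
  · have h := P.inclM_mul_inclM_eq_inclM_mul_inclTH x y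
    rw [P.inclTH_eq_tangentHom] at h
    exact congrArg Prod.snd (CocycleMatchedPair.eq_of_factorization he h)
  · rw [P.inclTH_eq_tangentHom]
    exact he (x, Y)
  · rw [P.inclM_mul_inclM]
    exact leftTriv.apply_symm_apply _
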